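/- Let $\mathsf{RCA}_0^\omega=\mathsf{E\text{-}PRA}^\omega+\mathsf{QF\text{-}AC}^{1,0}$ be Kohlenbach's base theory of higher-order reverse mathematics: classical logic in all finite types, with the constants $0$, $S$, the combinators $\Pi,\Sigma$ and the recursor $R_0$ of type $0$, the axiom of extensionality, quantifier-free induction, and the axiom of choice $\forall f^1\exists n^0\varphi(f,n)\to\exists F^2\forall f\,\varphi(f,F(f))$ for quantifier-free $\varphi$. Sets of numbers are binary characteristic functions of type $1=0\to0$. A partial order is a set $X^1$ of coded pairs, with $i\le_X j$ meaning $(i,j)\in X$, that is reflexive, antisymmetric and transitive on its field $\{i: i\le_X i\}$; it is infinite if its field is unbounded. Numbers $i,j$ are incomparable, $i\mid_X j$, if $i\not\le_X j$ and $j\not\le_X i$. A set $S$ contained in the field is a chain if any two of its elements are comparable, and an antichain if any two distinct elements are incomparable. A partial order $X$ is stable if for every $i$ in the field there is $s$ such that either $i<_X j$ for all $j>s$ in the field, or $i\mid_X j$ for all $j>s$ in the field; or if the same holds with $i>_X j$ in place of $i<_X j$. Let $\mathsf{MU}(\mu^2)$ be the formula $\forall f^1\big[\exists n\,f(n)=0\to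 f(\mu(f))=0\big]$, and let $(\mu^2)$ be $\exists\mu^2\,\mathsf{MU}(\mu)$. Let $\mathsf{UCAC}(\Psi^{1\to1})$ say that for every infinite partial order $X$, $\Psi(X)$ is an infinite subset of the field of $X$ that is a chain or an antichain, and let $\mathsf{USCAC}(\Psi)$ say the same for infinite stable $X$ only. Let $\mathsf{UCAC}$ be $\exists\Psi\,\mathsf{UCAC}(\Psi)$, and $\mathsf{USCAC}$ be $\exists\Psi\,\mathsf{USCAC}(\Psi)$. **Corollary.** $\mathsf{RCA}_0^\omega$ proves $\mathsf{UCAC}\leftrightarrow(\mu^2)\leftrightarrow\mathsf{USCAC}$, and these equivalences are explicit in the following sense. 1. There is a closed term $s$ such that $\mathsf{RCA}_0^\omega\vdash\forall\mu^2\,[\mathsf{MU}(\mu)\to\mathsf{UCAC}(s(\mu))]$, and there is a closed term $s'$ such that $\mathsf{RCA}_0^\omega\vdash\forall\mu^2\,[\mathsf{MU}(\mu)\to\mathsf{USCAC}(s'(\mu))]$. 2. From $\Psi$ as in $\mathsf{UCAC}$, an operator $\mu$ is given by a term together with an unbounded search, as provided by $\mathsf{QF\text{-}AC}^{1,0}$: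 there are a quantifier-free formula $\varphi(n^0,f^1,\Psi)$ with no further free variables and a closed term $t$ such that $\mathsf{RCA}_0^\omega$ proves $$\forall\Psi\,[\mathsf{UCAC}(\Psi)\to\forall f^1\exists n^0\,\varphi(n,f,\Psi)],$$ $$\forall\Psi\,\forall\Theta^2\,\big[\mathsf{UCAC}(\Psi)\wedge\forall f^1\,\varphi(\Theta(f),f,\Psi)\to\mathsf{MU}(t(\Psi,\Theta))\big].$$ The same holds (with possibly different $\varphi,t$) for $\mathsf{USCAC}$ in place of $\mathsf{UCAC}$. -/

import Mathlib

/-! Kohlenbach's base theory `RCA_0^ω = E-PRA^ω + QF-AC^{1,0}`: finite types, combinator terms,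
formulas, and a classical natural deduction calculus. -/

namespace RCAω

/-- The finite types: `0`, and `σ → τ`. -/
inductive Ty : Type
  | nat : Ty
  | arr : Ty → Ty → Ty

infixr:60 " ⇾ " => Ty.arr

/-- Type `1`, i.e. `0 → 0`. -/
abbrev Ty.one : Ty := Ty.nat ⇾ Ty.nat
/-- Type `2`, i.e. `(0 → 0) → 0`. -/
abbrev Ty.two : Ty := Ty.one ⇾ Ty.nat

/-- Contexts list the types of the bound variables in scope. -/
abbrev Ctx : Type := List Ty

/-- Typed de Bruijn indices (bound variables). -/
inductive Var : Ctx → Ty → Type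
  | here {Γ : Ctx} {τ : Ty} : Var (τ :: Γ) τ
  | there {Γ : Ctx} {σ τ : Ty} : Var Γ τ → Var (σ :: Γ) τ

/-- Terms of `E-PRA^ω`. Bound variables are de Bruijn indices `bv`; there are infinitely many free
variables `fv τ n` of each type `τ`. The constants are `0`, the successor `S`, the combinators
`Π` (`kc`) and `Σ` (`sc`) of all types, and the recursor `R_0` for recursion of type `0`. -/
inductive Tm : Ctx → Ty → Type
  | bv {Γ : Ctx} {τ : Ty} : Var Γ τ → Tm Γ τ
  | fv {Γ : Ctx} (τ : Ty) (n : ℕ) : Tm Γ τ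
  | zero {Γ : Ctx} : Tm Γ Ty.nat
  | succ {Γ : Ctx} : Tm Γ (Ty.nat ⇾ Ty.nat)
  | kc {Γ : Ctx} (σ τ : Ty) : Tm Γ (σ ⇾ τ ⇾ σ)
  | sc {Γ : Ctx} (ρ σ τ : Ty) : Tm Γ ((ρ ⇾ σ ⇾ τ) ⇾ (ρ ⇾ σ) ⇾ ρ ⇾ τ)
  | rc {Γ : Ctx} : Tm Γ (Ty.nat ⇾ Ty.nat ⇾ (Ty.nat ⇾ Ty.nat ⇾ Ty.nat) ⇾ Ty.nat)
  | app {Γ : Ctx} {σ τ : Ty} : Tm Γ (σ ⇾ τ) → Tm Γ σ → Tm Γ τ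

infixl:80 " ⬝ " => Tm.app

/-- Formulas: the prime formulas are equations of type `0`; `⊥`, `→`, `∀` are primitive. -/
inductive Fm : Ctx → Type
  | eq {Γ : Ctx} : Tm Γ Ty.nat → Tm Γ Ty.nat → Fm Γ
  | bot {Γ : Ctx} : Fm Γ
  | imp {Γ : Ctx} : Fm Γ → Fm Γ → Fm Γ
  | all {Γ : Ctx} (τ : Ty) : Fm (τ :: Γ) → Fm Γ

/-! ### Substitution for bound variables -/

def Tm.rename {Γ Δ : Ctx} (r : ∀ τ : Ty, Var Γ τ → Var Δ τ) : {τ : Ty} → Tm Γ τ → Tm Δ τ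
  | _, .bv x => .bv (r _ x)
  | _, .fv τ n => .fv τ n
  | _, .zero => .zero
  | _, .succ => .succ
  | _, .kc σ τ => .kc σ τ
  | _, .sc ρ σ τ => .sc ρ σ τ
  | _, .rc => .rc
  | _, .app s t => .app (s.rename r) (t.rename r)

/-- Weakening: the same term with one more bound variable in scope. -/
def Tm.wk {Γ : Ctx} {σ τ : Ty} (t : Tm Γ τ) : Tm (σ :: Γ) τ := t.rename fun _ x => x.there

abbrev Sub (Γ Δ : Ctx) : Type := ∀ τ : Ty, Var Γ τ → Tm Δ τ

def Sub.nil {Δ : Ctx} : Sub [] Δ := fun _ x => nomatch x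

def Sub.cons {Γ Δ : Ctx} {σ : Ty} (t : Tm Δ σ) (s : Sub Γ Δ) : Sub (σ :: Γ) Δ
  | _, .here => t
  | _, .there x => s _ x

/-- Pushing a substitution under a quantifier. -/
def Sub.under {Γ Δ : Ctx} {σ : Ty} (s : Sub Γ Δ) : Sub (σ :: Γ) (σ :: Δ) :=
  Sub.cons (.bv .here) fun τ x => (s τ x).wk

def Tm.subst {Γ Δ : Ctx} (s : Sub Γ Δ) : {τ : Ty} → Tm Γ τ → Tm Δ τ
  | _, .bv x => s _ x
  | _, .fv τ n => .fv τ n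
  | _, .zero => .zero
  | _, .succ => .succ
  | _, .kc σ τ => .kc σ τ
  | _, .sc ρ σ τ => .sc ρ σ τ
  | _, .rc => .rc
  | _, .app t u => .app (t.subst s) (u.subst s)

def Fm.subst : {Γ Δ : Ctx} → Sub Γ Δ → Fm Γ → Fm Δ
  | _, _, s, .eq t u => .eq (t.subst s) (u.subst s)
  | _, _, _, .bot => .bot
  | _, _, s, .imp φ ψ => .imp (φ.subst s) (ψ.subst s)
  | _, _, s, .all τ φ => .all τ (φ.subst s.under)

/-- A term without bound variables, placed in an arbitrary context. -/
def Tm.lift {Γ : Ctx} {τ : Ty} (t : Tm [] τ) : Tm Γ τ := t.subst Sub.nil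

/-- `φ(t)` for a formula `φ(x)`. -/
def Fm.inst {Γ : Ctx} {σ : Ty} (φ : Fm [σ]) (t : Tm Γ σ) : Fm Γ := φ.subst (Sub.cons t Sub.nil)

/-! ### Free variables -/

/-- The free variable `fv τ n` does not occur in the term. -/
def Tm.Fresh (τ : Ty) (n : ℕ) : {Γ : Ctx} → {σ : Ty} → Tm Γ σ → Prop
  | _, _, .fv σ m => ¬ (σ = τ ∧ m = n)
  | _, _, .app s t => s.Fresh τ n ∧ t.Fresh τ n
  | _, _, _ => True

/-- The free variable `fv τ n` does not occur in the formula. -/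
def Fm.Fresh (τ : Ty) (n : ℕ) : {Γ : Ctx} → Fm Γ → Prop
  | _, .eq s t => s.Fresh τ n ∧ t.Fresh τ n
  | _, .bot => True
  | _, .imp φ ψ => φ.Fresh τ n ∧ ψ.Fresh τ n
  | _, .all _ φ => φ.Fresh τ n

/-- No free variables occur. -/
def Tm.Closed {Γ : Ctx} {σ : Ty} (t : Tm Γ σ) : Prop := ∀ τ n, t.Fresh τ n

/-- No free variables occur. -/
def Fm.Closed {Γ : Ctx} (φ : Fm Γ) : Prop := ∀ τ n, φ.Fresh τ n

/-- Quantifier-free formulas. -/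
def Fm.QF : {Γ : Ctx} → Fm Γ → Prop
  | _, .eq _ _ => True
  | _, .bot => True
  | _, .imp φ ψ => φ.QF ∧ ψ.QF
  | _, .all _ _ => False

/-! ### Defined connectives and equality in higher types -/

/-- The bound variables, innermost first. -/
abbrev v0 {Γ : Ctx} {τ : Ty} : Tm (τ :: Γ) τ := .bv .here
abbrev v1 {Γ : Ctx} {σ τ : Ty} : Tm (σ :: τ :: Γ) τ := .bv (.there .here)
abbrev v2 {Γ : Ctx} {ρ σ τ : Ty} : Tm (ρ :: σ :: τ :: Γ) τ := .bv (.there (.there .here))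

def Fm.not {Γ : Ctx} (φ : Fm Γ) : Fm Γ := .imp φ .bot
def Fm.and {Γ : Ctx} (φ ψ : Fm Γ) : Fm Γ := (φ.imp ψ.not).not
def Fm.or {Γ : Ctx} (φ ψ : Fm Γ) : Fm Γ := φ.not.imp ψ
def Fm.iff {Γ : Ctx} (φ ψ : Fm Γ) : Fm Γ := (φ.imp ψ).and (ψ.imp φ)
def Fm.ex {Γ : Ctx} (τ : Ty) (φ : Fm (τ :: Γ)) : Fm Γ := (Fm.all τ φ.not).not

/-- `∀ x, f x` and `∃ x, f x`, where `f` is applied to the bound variable. -/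
def Fm.allx {Γ : Ctx} (τ : Ty) (f : Tm (τ :: Γ) τ → Fm (τ :: Γ)) : Fm Γ := .all τ (f v0)
def Fm.exx {Γ : Ctx} (τ : Ty) (f : Tm (τ :: Γ) τ → Fm (τ :: Γ)) : Fm Γ := .ex τ (f v0)

/-- Equality of type `τ`: `s z₁ … z_k =_0 t z₁ … z_k` for all `z₁ … z_k`. -/
def Fm.eqT : {Γ : Ctx} → (τ : Ty) → Tm Γ τ → Tm Γ τ → Fm Γ
  | _, .nat, s, t => .eq s t
  | _, .arr σ τ, s, t => .all σ (Fm.eqT τ (s.wk ⬝ v0) (t.wk ⬝ v0))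

/-! ### The theory -/

/-- The non-logical axioms of `RCA_0^ω`. The terms and formulas in them may contain
free variables of any type; these are read universally. -/
inductive Axm : Fm [] → Prop
  | eq_refl (t : Tm [] Ty.nat) : Axm (.eq t t)
  | eq_symm (s t : Tm [] Ty.nat) : Axm (.imp (.eq s t) (.eq t s))
  | eq_trans (r s t : Tm [] Ty.nat) : Axm (.imp (.eq r s) (.imp (.eq s t) (.eq r t)))
  /-- The axiom of extensionality. -/
  | ext (σ τ : Ty) (f : Tm [] (σ ⇾ τ)) (s t : Tm [] σ) :
      Axm (.imp (.eqT σ s t) (.eqT τ (f ⬝ s) (f ⬝ t)))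
  | succ_ne_zero (t : Tm [] Ty.nat) : Axm (Fm.not (.eq (.succ ⬝ t) .zero))
  | succ_inj (s t : Tm [] Ty.nat) : Axm (.imp (.eq (.succ ⬝ s) (.succ ⬝ t)) (.eq s t))
  | kc_eq (σ τ : Ty) (s : Tm [] σ) (t : Tm [] τ) : Axm (.eqT σ (.kc σ τ ⬝ s ⬝ t) s)
  | sc_eq (ρ σ τ : Ty) (r : Tm [] (ρ ⇾ σ ⇾ τ)) (s : Tm [] (ρ ⇾ σ)) (t : Tm [] ρ) :
      Axm (.eqT τ (.sc ρ σ τ ⬝ r ⬝ s ⬝ t) (r ⬝ t ⬝ (s ⬝ t)))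
  | rc_zero (y : Tm [] Ty.nat) (z : Tm [] (Ty.nat ⇾ Ty.nat ⇾ Ty.nat)) :
      Axm (.eq (.rc ⬝ .zero ⬝ y ⬝ z) y)
  | rc_succ (x y : Tm [] Ty.nat) (z : Tm [] (Ty.nat ⇾ Ty.nat ⇾ Ty.nat)) :
      Axm (.eq (.rc ⬝ (.succ ⬝ x) ⬝ y ⬝ z) (z ⬝ (.rc ⬝ x ⬝ y ⬝ z) ⬝ x))
  /-- Quantifier-free induction. -/
  | qf_ind (φ : Fm [Ty.nat]) : φ.QF →
      Axm (.imp (φ.inst .zero)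
        (.imp (.all Ty.nat (.imp φ (φ.inst (.succ ⬝ v0)))) (.all Ty.nat φ)))
  /-- `QF-AC^{1,0}`: if `∀ f^1 ∃ n^0 φ(f, n)`, then `∃ F^2 ∀ f^1 φ(f, F f)`. -/
  | qf_ac (φ : Fm [Ty.nat, Ty.one]) : φ.QF →
      Axm (.imp (.all Ty.one (.ex Ty.nat φ))
        (.ex Ty.two (.all Ty.one (φ.subst (Sub.cons (v1 ⬝ v0) (Sub.cons v0 Sub.nil))))))

/-- Classical natural deduction from the axioms of `RCA_0^ω` and a list of hypotheses. -/
inductive Prf : List (Fm []) → Fm [] → Prop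
  | ax {H : List (Fm [])} {φ : Fm []} : Axm φ → Prf H φ
  | hyp {H : List (Fm [])} {φ : Fm []} : φ ∈ H → Prf H φ
  | impI {H : List (Fm [])} {φ ψ : Fm []} : Prf (φ :: H) ψ → Prf H (.imp φ ψ)
  | impE {H : List (Fm [])} {φ ψ : Fm []} : Prf H (.imp φ ψ) → Prf H φ → Prf H ψ
  | raa {H : List (Fm [])} {φ : Fm []} : Prf (φ.not :: H) .bot → Prf H φ
  | allI {H : List (Fm [])} {τ : Ty} {φ : Fm [τ]} (n : ℕ) : φ.Fresh τ n →
      (∀ ψ ∈ H, Fm.Fresh τ n ψ) → Prf H (φ.inst (.fv τ n)) → Prf H (.all τ φ)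
  | allE {H : List (Fm [])} {τ : Ty} {φ : Fm [τ]} (t : Tm [] τ) :
      Prf H (.all τ φ) → Prf H (φ.inst t)

/-- Provability in `RCA_0^ω`. -/
def Provable (φ : Fm []) : Prop := Prf [] φ

/-- The implication `∃ Φ, A(Φ) → ∃ Ψ, B(Ψ)` is explicit by means of a term: there is a closed term
`t` with `∀ Φ (A(Φ) → B(t Φ))`. -/
def Explicit {ρ σ : Ty} (A : Fm [ρ]) (B : Fm [σ]) : Prop :=
  ∃ t : Tm [] (ρ ⇾ σ), t.Closed ∧ Provable (.all ρ (.imp A (B.inst (t.lift ⬝ v0))))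

/-- The implication `∃ Φ, A(Φ) → ∃ Ψ, B(Ψ)` is explicit by means of a term and an unbounded search:
for a quantifier-free `φ` with `A(Φ) → ∀ f^1 ∃ n^0 φ(n, f, Φ)` and a closed term `t`, any
functional `Θ^2` that finds such `n` (as provided by `QF-AC^{1,0}`) satisfies
`A(Φ) → B(t Φ Θ)`. -/
def ExplicitSearch {ρ σ : Ty} (A : Fm [ρ]) (B : Fm [σ]) : Prop :=
  ∃ (φ : Fm [Ty.nat, Ty.one, ρ]) (t : Tm [] (ρ ⇾ Ty.two ⇾ σ)),
    φ.QF ∧ φ.Closed ∧ t.Closed ∧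
    Provable (.all ρ (.imp A (.all Ty.one (.ex Ty.nat φ)))) ∧
    Provable (.all ρ (.all Ty.two
      (.imp (A.inst v1)
        (.imp (.all Ty.one
            (φ.subst (Sub.cons (v1 ⬝ v0) (Sub.cons v0 (Sub.cons v2 Sub.nil)))))
          (B.inst (t.lift ⬝ v1 ⬝ v0))))))

/-! ### Arithmetic -/

/-- The term `λ u v. S u`. -/
def stepSucc {Γ : Ctx} : Tm Γ (Ty.nat ⇾ Ty.nat ⇾ Ty.nat) :=
  .sc _ _ _ ⬝ (.kc _ _ ⬝ .kc _ _) ⬝ .succ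

/-- `s + t`. -/
def Tm.add {Γ : Ctx} (s t : Tm Γ Ty.nat) : Tm Γ Ty.nat := .rc ⬝ t ⬝ s ⬝ stepSucc

/-- The term `λ u v. u + s`. -/
def stepAdd {Γ : Ctx} (s : Tm Γ Ty.nat) : Tm Γ (Ty.nat ⇾ Ty.nat ⇾ Ty.nat) :=
  .sc _ _ _ ⬝ (.kc _ _ ⬝ .kc _ _) ⬝ (.sc _ _ _ ⬝ (.rc ⬝ s) ⬝ (.kc _ _ ⬝ stepSucc))

/-- `s · t`. -/
def Tm.mul {Γ : Ctx} (s t : Tm Γ Ty.nat) : Tm Γ Ty.nat := .rc ⬝ t ⬝ .zero ⬝ stepAdd s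

/-- The code `(s + t)² + s` of the pair `(s, t)`. -/
def Tm.pair {Γ : Ctx} (s t : Tm Γ Ty.nat) : Tm Γ Ty.nat := ((s.add t).mul (s.add t)).add s

/-- `s < t`. -/
def Fm.lt {Γ : Ctx} (s t : Tm Γ Ty.nat) : Fm Γ :=
  .exx Ty.nat fun w => .eq (s.wk.add (.succ ⬝ w)) t.wk

/-! ### Sets, partial orders, chains and antichains -/

/-- `X` is the (binary) characteristic function of a set. -/
def Fm.isSet {Γ : Ctx} (X : Tm Γ Ty.one) : Fm Γ :=
  .allx Ty.nat fun n => .or (.eq (X.wk ⬝ n) .zero) (.eq (X.wk ⬝ n) (.succ ⬝ .zero))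

/-- `x ∈ X`. -/
def Fm.mem {Γ : Ctx} (x : Tm Γ Ty.nat) (X : Tm Γ Ty.one) : Fm Γ := .eq (X ⬝ x) (.succ ⬝ .zero)

/-- `i ≤_X j`, where `X` is a set of coded pairs. -/
def Fm.le {Γ : Ctx} (X : Tm Γ Ty.one) (i j : Tm Γ Ty.nat) : Fm Γ := .mem (i.pair j) X

/-- `i` is in the field `{i : i ≤_X i}` of the reflexive relation `X`. -/
def Fm.inField {Γ : Ctx} (X : Tm Γ Ty.one) (i : Tm Γ Ty.nat) : Fm Γ := .le X i i

/-- `X` is a (reflexive) partial order on its field. -/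
def Fm.isPO {Γ : Ctx} (X : Tm Γ Ty.one) : Fm Γ :=
  .and (.isSet X) <|
  .and (.allx Ty.nat fun i => .allx Ty.nat fun j =>
    .imp (.le X.wk.wk i.wk j) (.and (.inField X.wk.wk i.wk) (.inField X.wk.wk j))) <|
  .and (.allx Ty.nat fun i => .allx Ty.nat fun j =>
    .imp (.le X.wk.wk i.wk j) (.imp (.le X.wk.wk j i.wk) (.eq i.wk j)))
  (.allx Ty.nat fun i => .allx Ty.nat fun j => .allx Ty.nat fun k =>
    .imp (.le X.wk.wk.wk i.wk.wk j.wk)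
      (.imp (.le X.wk.wk.wk j.wk k) (.le X.wk.wk.wk i.wk.wk k)))

/-- `X` is a partial order whose field is unbounded. -/
def Fm.isInfPO {Γ : Ctx} (X : Tm Γ Ty.one) : Fm Γ :=
  .and (.isPO X)
    (.allx Ty.nat fun k => .exx Ty.nat fun n => .and (.lt k.wk n) (.inField X.wk.wk n))

/-- `i` and `j` are incomparable in `X`. -/
def Fm.incomp {Γ : Ctx} (X : Tm Γ Ty.one) (i j : Tm Γ Ty.nat) : Fm Γ :=
  .and (Fm.not (.le X i j)) (Fm.not (.le X j i))

/-- `i <_X j`. -/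
def Fm.slt {Γ : Ctx} (X : Tm Γ Ty.one) (i j : Tm Γ Ty.nat) : Fm Γ :=
  .and (.le X i j) (Fm.not (.eq i j))

/-- The partial order `X` is stable: either every `i` in the field is, for almost all `j` in the
field, `<_X`-below `j`, or else, for almost all `j`, incomparable with `j`; or the same holds with
`>_X` for `<_X`. -/
def Fm.isStable {Γ : Ctx} (X : Tm Γ Ty.one) : Fm Γ :=
  .or
    (.allx Ty.nat fun i => .imp (.inField X.wk i) <| .exx Ty.nat fun s => .or
      (.allx Ty.nat fun j => .imp (.lt s.wk j) <| .imp (.inField X.wk.wk.wk j)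
        (.slt X.wk.wk.wk i.wk.wk j))
      (.allx Ty.nat fun j => .imp (.lt s.wk j) <| .imp (.inField X.wk.wk.wk j)
        (.incomp X.wk.wk.wk i.wk.wk j)))
    (.allx Ty.nat fun i => .imp (.inField X.wk i) <| .exx Ty.nat fun s => .or
      (.allx Ty.nat fun j => .imp (.lt s.wk j) <| .imp (.inField X.wk.wk.wk j)
        (.slt X.wk.wk.wk j i.wk.wk))
      (.allx Ty.nat fun j => .imp (.lt s.wk j) <| .imp (.inField X.wk.wk.wk j)
        (.incomp X.wk.wk.wk i.wk.wk j)))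

/-- `S` is an infinite set contained in the field of `X`. -/
def Fm.isInfSubset {Γ : Ctx} (X S : Tm Γ Ty.one) : Fm Γ :=
  .and (.isSet S) <|
  .and (.allx Ty.nat fun n => .imp (.mem n S.wk) (.inField X.wk n))
  (.allx Ty.nat fun k => .exx Ty.nat fun n => .and (.lt k.wk n) (.mem n S.wk.wk))

/-- `S` is a chain in `X`. -/
def Fm.isChain {Γ : Ctx} (X S : Tm Γ Ty.one) : Fm Γ :=
  .allx Ty.nat fun x => .allx Ty.nat fun y => .imp (.mem x.wk S.wk.wk) <| .imp (.mem y S.wk.wk) <|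
    .or (.le X.wk.wk x.wk y) (.le X.wk.wk y x.wk)

/-- `S` is an antichain in `X`: distinct elements are incomparable. -/
def Fm.isAntichain {Γ : Ctx} (X S : Tm Γ Ty.one) : Fm Γ :=
  .allx Ty.nat fun x => .allx Ty.nat fun y => .imp (.mem x.wk S.wk.wk) <| .imp (.mem y S.wk.wk) <|
    .imp (Fm.not (.eq x.wk y)) (.incomp X.wk.wk x.wk y)

/-- `S` is an infinite subset of `X` that is a chain or an antichain. -/
def Fm.isSolution {Γ : Ctx} (X S : Tm Γ Ty.one) : Fm Γ :=
  .and (.isInfSubset X S) (.or (.isChain X S) (.isAntichain X S))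

/-! ### The principles -/

/-- `UCAC(Ψ)`, with `Ψ` the variable in scope. -/
def UCAC : Fm [Ty.one ⇾ Ty.one] :=
  .allx Ty.one fun X => .imp (.isInfPO X) (.isSolution X (v1 ⬝ X))

/-- `USCAC(Ψ)`, with `Ψ` the variable in scope. -/
def USCAC : Fm [Ty.one ⇾ Ty.one] :=
  .allx Ty.one fun X => .imp (.and (.isInfPO X) (.isStable X)) (.isSolution X (v1 ⬝ X))

/-- `MU(μ)`, with `μ` the variable in scope: if `f` has a zero, then `f(μ(f)) = 0`. -/
def MU : Fm [Ty.two] :=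
  .allx Ty.one fun f =>
    .imp (.exx Ty.nat fun n => .eq (f.wk ⬝ n) .zero) (.eq (f ⬝ (v1 ⬝ f)) .zero)

end RCAω

/-! Provability is replaced by truth. A Henkin construction yields completeness (`provable_of_sat`):
a sentence is provable once it holds in every extensional structure that satisfies the axioms and in
which each element is the value of a term. In such a model the numbers, possibly nonstandard, form
an ordered semiring, and induction is directly available only for predicates defined by
quantifier-free formulas (`ind`).

From `Ψ` to `μ`: given `f`, put `i` below a larger `j` exactly when `f` has a zero `≤ i`. This
infinite partial order is stable, since numbers below the least zero are isolated and all others lie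
below every larger number. Suppose `f` has a zero. Two elements of a solution beyond it are
comparable, so the solution is not an antichain. In a chain, each element `n` is comparable with a
larger one, which forces a zero `≤ n` (`exists_zero_le`). So any element of the solution bounds the
search for a zero. Membership in the solution is quantifier-free, hence `QF-AC^{1,0}` picks such an
element as a functional of `f`. Stability makes the same argument work for `USCAC`.

From `μ` to `Ψ`: number quantifiers can be decided by `μ`, so every arithmetical formula has a
characteristic term (`eval_chi`) and induction extends to arithmetical predicates (`Dec.arith`).
This suffices for the Erdős–Rado proof of Ramsey's theorem for pairs, coloured by comparability. An
infinite branch through the tree of comparability patterns gives an increasing sequence in the field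
on which the colour of a pair depends only on its smaller element (`enum_comp`), and one of the two
colours is then selected arithmetically. The resulting term also witnesses the weaker `USCAC`. -/

namespace RCAω

/-! ### Renaming free variables and weakening -/

/-- Renaming the free variables of a term. -/
def Tm.ren (r : Ty → ℕ → ℕ) {Γ : Ctx} : {τ : Ty} → Tm Γ τ → Tm Γ τ
  | _, .bv x => .bv x
  | _, .fv τ n => .fv τ (r τ n)
  | _, .zero => .zero
  | _, .succ => .succ
  | _, .kc σ τ => .kc σ τ
  | _, .sc ρ σ τ => .sc ρ σ τ
  | _, .rc => .rc
  | _, .app s t => .app (s.ren r) (t.ren r)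

/-- Renaming the free variables of a formula. -/
def Fm.ren (r : Ty → ℕ → ℕ) : {Γ : Ctx} → Fm Γ → Fm Γ
  | _, .eq s t => .eq (s.ren r) (t.ren r)
  | _, .bot => .bot
  | _, .imp φ ψ => .imp (φ.ren r) (ψ.ren r)
  | _, .all τ φ => .all τ (φ.ren r)

theorem Tm.ren_rename (r : Ty → ℕ → ℕ) {Γ Δ : Ctx} (f : ∀ τ : Ty, Var Γ τ → Var Δ τ) {τ : Ty}
    (t : Tm Γ τ) : (t.rename f).ren r = (t.ren r).rename f := by
  induction t <;> simp_all [Tm.ren, Tm.rename]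

theorem Tm.ren_wk (r : Ty → ℕ → ℕ) {Γ : Ctx} {σ τ : Ty} (t : Tm Γ τ) :
    (t.wk (σ := σ)).ren r = (t.ren r).wk := Tm.ren_rename r _ t

theorem Tm.ren_subst (r : Ty → ℕ → ℕ) {Γ Δ : Ctx} (s : Sub Γ Δ) {τ : Ty} (t : Tm Γ τ) :
    (t.subst s).ren r = (t.ren r).subst fun τ x => (s τ x).ren r := by
  induction t <;> simp_all [Tm.ren, Tm.subst]

theorem Sub.ren_under (r : Ty → ℕ → ℕ) {Γ Δ : Ctx} {σ : Ty} (s : Sub Γ Δ) :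
    (fun τ x => ((Sub.under (σ := σ) s) τ x).ren r) = Sub.under fun τ x => (s τ x).ren r := by
  funext τ x
  cases x with
  | here => rfl
  | there x => exact Tm.ren_wk r _

theorem Sub.ren_cons (r : Ty → ℕ → ℕ) {Γ Δ : Ctx} {σ : Ty} (t : Tm Δ σ) (s : Sub Γ Δ) :
    (fun τ x => ((Sub.cons t s) τ x).ren r) = Sub.cons (t.ren r) fun τ x => (s τ x).ren r := by
  funext τ x
  cases x <;> rfl

theorem Sub.nil_ext {Δ : Ctx} (s s' : Sub [] Δ) : s = s' := by
  funext τ x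
  nomatch x

theorem Fm.ren_subst (r : Ty → ℕ → ℕ) {Γ Δ : Ctx} (s : Sub Γ Δ) (φ : Fm Γ) :
    (φ.subst s).ren r = (φ.ren r).subst fun τ x => (s τ x).ren r := by
  induction φ generalizing Δ with
  | eq => simp [Fm.subst, Fm.ren, Tm.ren_subst]
  | bot => rfl
  | imp _ _ h₁ h₂ => simp [Fm.subst, Fm.ren, h₁, h₂]
  | all τ φ h => simp [Fm.subst, Fm.ren, h, Sub.ren_under]

theorem Fm.ren_inst (r : Ty → ℕ → ℕ) {Γ : Ctx} {σ : Ty} (φ : Fm [σ]) (t : Tm Γ σ) :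
    (φ.inst t).ren r = (φ.ren r).inst (t.ren r) := by
  rw [Fm.inst, Fm.ren_subst, Sub.ren_cons, Sub.nil_ext (fun τ x => _) Sub.nil]
  rfl

theorem Fm.ren_eqT (r : Ty → ℕ → ℕ) {Γ : Ctx} (τ : Ty) (s t : Tm Γ τ) :
    (Fm.eqT τ s t).ren r = Fm.eqT τ (s.ren r) (t.ren r) := by
  induction τ generalizing Γ with
  | nat => rfl
  | arr σ τ _ h => simp [Fm.eqT, Fm.ren, h, Tm.ren, Tm.ren_wk]

theorem Fm.QF.ren (r : Ty → ℕ → ℕ) {Γ : Ctx} {φ : Fm Γ} (h : φ.QF) : (φ.ren r).QF := by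
  induction φ with
  | imp _ _ h₁ h₂ => exact ⟨h₁ h.1, h₂ h.2⟩
  | _ => exact h

theorem Axm.ren (r : Ty → ℕ → ℕ) {φ : Fm []} (h : Axm φ) : Axm (φ.ren r) := by
  cases h with
  | ext σ τ f s t =>
    simp only [Fm.ren, Fm.ren_eqT]
    exact .ext ..
  | kc_eq σ τ s t =>
    simp only [Fm.ren_eqT]
    exact .kc_eq ..
  | sc_eq ρ σ τ a b c =>
    simp only [Fm.ren_eqT]
    exact .sc_eq ..
  | qf_ind φ h =>
    simp only [Fm.ren, Fm.ren_inst]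
    exact .qf_ind _ (h.ren r)
  | qf_ac φ h =>
    simp only [Fm.ren, Fm.ex, Fm.not, Fm.ren_subst, Sub.ren_cons]
    rw [Sub.nil_ext (fun τ x => _) Sub.nil]
    exact .qf_ac _ (h.ren r)
  | eq_refl => exact .eq_refl _
  | eq_symm => exact .eq_symm _ _
  | eq_trans => exact .eq_trans _ _ _
  | succ_ne_zero => exact .succ_ne_zero _
  | succ_inj => exact .succ_inj _ _
  | rc_zero => exact .rc_zero _ _
  | rc_succ => exact .rc_succ _ _ _

@[simp] theorem Tm.fresh_fv {τ σ : Ty} {n m : ℕ} {Γ : Ctx} :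
    (.fv σ m : Tm Γ σ).Fresh τ n ↔ ¬ (σ = τ ∧ m = n) := by simp [Tm.Fresh]

@[simp] theorem Tm.fresh_app {ρ σ τ : Ty} {n : ℕ} {Γ : Ctx} {s : Tm Γ (σ ⇾ τ)} {t : Tm Γ σ} :
    (s ⬝ t).Fresh ρ n ↔ s.Fresh ρ n ∧ t.Fresh ρ n := by simp [Tm.Fresh]

theorem Tm.ren_congr {r r' : Ty → ℕ → ℕ} {τ : Ty} {n : ℕ}
    (hr : ∀ σ m, ¬ (σ = τ ∧ m = n) → r σ m = r' σ m) {Γ : Ctx} {σ : Ty} (t : Tm Γ σ)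
    (ht : t.Fresh τ n) : t.ren r = t.ren r' := by
  induction t with
  | fv σ m => exact congrArg _ (hr σ m (Tm.fresh_fv.1 ht))
  | app s t h₁ h₂ =>
    rw [Tm.fresh_app] at ht
    simp only [Tm.ren, h₁ ht.1, h₂ ht.2]
  | _ => rfl

theorem Fm.ren_congr {r r' : Ty → ℕ → ℕ} {τ : Ty} {n : ℕ}
    (hr : ∀ σ m, ¬ (σ = τ ∧ m = n) → r σ m = r' σ m) {Γ : Ctx} (φ : Fm Γ)
    (h : φ.Fresh τ n) : φ.ren r = φ.ren r' := by
  induction φ with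
  | eq s t => simp only [Fm.ren, Tm.ren_congr hr _ h.1, Tm.ren_congr hr _ h.2]
  | bot => rfl
  | imp φ ψ h₁ h₂ => simp only [Fm.ren, h₁ h.1, h₂ h.2]
  | all τ φ ih => simp only [Fm.ren, ih h]

theorem Tm.ren_id {Γ : Ctx} {σ : Ty} (t : Tm Γ σ) : t.ren (fun _ n => n) = t := by
  induction t <;> simp_all [Tm.ren]

theorem Fm.ren_id {Γ : Ctx} (φ : Fm Γ) : φ.ren (fun _ n => n) = φ := by
  induction φ <;> simp_all [Fm.ren, Tm.ren_id]

theorem Tm.exists_fresh {Γ : Ctx} {σ : Ty} (t : Tm Γ σ) :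
    ∃ N, ∀ n, N ≤ n → ∀ τ, t.Fresh τ n := by
  induction t with
  | fv σ m => exact ⟨m + 1, fun n hn τ => Tm.fresh_fv.2 (by omega)⟩
  | app s t h₁ h₂ =>
    obtain ⟨N₁, h₁⟩ := h₁
    obtain ⟨N₂, h₂⟩ := h₂
    exact ⟨max N₁ N₂, fun n hn τ => Tm.fresh_app.2 ⟨h₁ n (by omega) τ, h₂ n (by omega) τ⟩⟩
  | _ => exact ⟨0, fun _ _ _ => by simp [Tm.Fresh]⟩

theorem Fm.exists_fresh {Γ : Ctx} (φ : Fm Γ) : ∃ N, ∀ n, N ≤ n → ∀ τ, φ.Fresh τ n := by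
  induction φ with
  | eq s t =>
    obtain ⟨N₁, h₁⟩ := s.exists_fresh
    obtain ⟨N₂, h₂⟩ := t.exists_fresh
    exact ⟨max N₁ N₂, fun n hn τ => ⟨h₁ n (by omega) τ, h₂ n (by omega) τ⟩⟩
  | bot => exact ⟨0, fun _ _ _ => trivial⟩
  | imp s t h₁ h₂ =>
    obtain ⟨N₁, h₁⟩ := h₁
    obtain ⟨N₂, h₂⟩ := h₂
    exact ⟨max N₁ N₂, fun n hn τ => ⟨h₁ n (by omega) τ, h₂ n (by omega) τ⟩⟩
  | all τ φ h => exact h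

theorem exists_fresh_list (H : List (Fm [])) :
    ∃ N, ∀ n, N ≤ n → ∀ τ, ∀ ψ ∈ H, ψ.Fresh τ n := by
  induction H with
  | nil => simp
  | cons φ H h =>
    obtain ⟨N₁, h₁⟩ := h
    obtain ⟨N₂, h₂⟩ := φ.exists_fresh
    refine ⟨max N₁ N₂, fun n hn τ ψ hψ => ?_⟩
    rcases List.mem_cons.1 hψ with rfl | hψ
    · exact h₂ n (by omega) τ
    · exact h₁ n (by omega) τ ψ hψ

/-- Weakening alone does not go through by induction: the eigenvariable of a generalisation may
occur in the new hypotheses. With an arbitrary renaming built into the statement, it can be replaced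
by a fresh one. -/
theorem Prf.ren {H : List (Fm [])} {φ : Fm []} (h : Prf H φ) (r : Ty → ℕ → ℕ)
    (H' : List (Fm [])) (hH : ∀ ψ ∈ H, ψ.ren r ∈ H') : Prf H' (φ.ren r) := by
  induction h generalizing r H' with
  | ax h => exact .ax (h.ren r)
  | hyp h => exact .hyp (hH _ h)
  | @impI H φ ψ _ ih =>
    refine .impI (ih r (φ.ren r :: H') fun χ hχ => ?_)
    rcases List.mem_cons.1 hχ with rfl | hχ
    · exact List.mem_cons_self
    · exact List.mem_cons_of_mem _ (hH χ hχ)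
  | impE _ _ ih₁ ih₂ => exact .impE (ih₁ r H' hH) (ih₂ r H' hH)
  | @raa H φ _ ih =>
    refine .raa (ih r ((φ.ren r).not :: H') fun χ hχ => ?_)
    rcases List.mem_cons.1 hχ with rfl | hχ
    · exact List.mem_cons_self
    · exact List.mem_cons_of_mem _ (hH χ hχ)
  | @allI H τ φ n hφ hn _ ih =>
    obtain ⟨N₁, h₁⟩ := exists_fresh_list H'
    obtain ⟨N₂, h₂⟩ := (φ.ren r).exists_fresh
    let m := max N₁ N₂
    -- The modified renaming differs from `r` only at the eigenvariable, which is absent from `φ`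
    -- and from the hypotheses, so on those the two agree.
    let r' : Ty → ℕ → ℕ := fun σ k => by classical exact if σ = τ ∧ k = n then m else r σ k
    have hr : ∀ σ k, ¬ (σ = τ ∧ k = n) → r' σ k = r σ k := fun σ k h => if_neg h
    refine .allI m (h₂ m (le_max_right _ _) τ) (h₁ m (le_max_left _ _) τ) ?_
    have := ih r' H' fun χ hχ => by
      rw [Fm.ren_congr hr χ (hn χ hχ)]
      exact hH χ hχ
    rw [Fm.ren_inst, Fm.ren_congr hr φ hφ] at this
    rwa [show Tm.ren r' (.fv τ n : Tm [] τ) = .fv τ m by simp [Tm.ren, r']] at this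
  | allE t _ ih =>
    rw [Fm.ren_inst]
    exact .allE _ (ih r H' hH)

/-- Weakening. -/
theorem Prf.weaken {H H' : List (Fm [])} {φ : Fm []} (h : Prf H φ) (hH : H ⊆ H') : Prf H' φ := by
  rw [← φ.ren_id]
  exact h.ren _ H' fun ψ hψ => by rw [ψ.ren_id]; exact hH hψ

/-! ### Formulas are countable -/

def Ty.code : Ty → ℕ
  | .nat => 0
  | .arr σ τ => Nat.pair σ.code τ.code + 1

theorem Ty.code_inj : ∀ {σ τ : Ty}, σ.code = τ.code → σ = τ := by
  intro σ
  induction σ with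
  | nat => intro τ h; cases τ <;> simp_all [Ty.code]
  | arr σ τ h₁ h₂ =>
    intro ρ h
    cases ρ with
    | nat => simp [Ty.code] at h
    | arr σ' τ' =>
      simp only [Ty.code, Nat.add_right_cancel_iff, Nat.pair_eq_pair] at h
      rw [h₁ h.1, h₂ h.2]

def Var.code : {Γ : Ctx} → {τ : Ty} → Var Γ τ → ℕ
  | _, _, .here => 0
  | _, _, .there x => x.code + 1

theorem Var.code_inj {Γ : Ctx} {τ : Ty} {x y : Var Γ τ} (h : x.code = y.code) : x = y := by
  induction x with
  | here => cases y with
    | here => rfl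
    | there y => simp [Var.code] at h
  | there x ih => cases y with
    | here => simp [Var.code] at h
    | there y =>
      simp only [Var.code, Nat.add_right_cancel_iff] at h
      rw [ih h]

/-- The context and type of a term are indices, so most type annotations need no coding. Only an
application hides a type, that of its argument. -/
def Tm.code : {Γ : Ctx} → {τ : Ty} → Tm Γ τ → ℕ
  | _, _, .bv x => Nat.pair 0 x.code
  | _, _, .fv _ n => Nat.pair 1 n
  | _, _, .zero => Nat.pair 2 0
  | _, _, .succ => Nat.pair 3 0
  | _, _, .kc _ _ => Nat.pair 4 0
  | _, _, .sc _ _ _ => Nat.pair 5 0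
  | _, _, .rc => Nat.pair 6 0
  | _, _, .app (σ := σ) s t => Nat.pair 7 (Nat.pair σ.code (Nat.pair s.code t.code))

theorem Tm.code_inj {Γ : Ctx} {τ : Ty} {s t : Tm Γ τ} (h : s.code = t.code) : s = t := by
  induction s with
  | app s₁ s₂ h₁ h₂ =>
    cases t with
    | app t₁ t₂ =>
      simp only [Tm.code, Nat.pair_eq_pair, true_and] at h
      obtain rfl := Ty.code_inj h.1
      rw [h₁ h.2.1, h₂ h.2.2]
    | _ => simp [Tm.code] at h
  | bv x =>
    cases t with
    | bv y =>
      simp only [Tm.code, Nat.pair_eq_pair, true_and] at h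
      rw [Var.code_inj h]
    | _ => simp [Tm.code] at h
  | _ => cases t <;> simp_all [Tm.code]

def Fm.code : {Γ : Ctx} → Fm Γ → ℕ
  | _, .eq s t => Nat.pair 0 (Nat.pair s.code t.code)
  | _, .bot => Nat.pair 1 0
  | _, .imp φ ψ => Nat.pair 2 (Nat.pair φ.code ψ.code)
  | _, .all τ φ => Nat.pair 3 (Nat.pair τ.code φ.code)

theorem Fm.code_inj {Γ : Ctx} {φ ψ : Fm Γ} (h : φ.code = ψ.code) : φ = ψ := by
  induction φ with
  | eq s t =>
    cases ψ with
    | eq s' t' =>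
      simp only [Fm.code, Nat.pair_eq_pair, true_and] at h
      rw [Tm.code_inj h.1, Tm.code_inj h.2]
    | _ => simp [Fm.code] at h
  | bot => cases ψ <;> simp_all [Fm.code]
  | imp φ₁ φ₂ h₁ h₂ =>
    cases ψ with
    | imp ψ₁ ψ₂ =>
      simp only [Fm.code, Nat.pair_eq_pair, true_and] at h
      rw [h₁ h.1, h₂ h.2]
    | _ => simp [Fm.code] at h
  | all τ φ ih =>
    cases ψ with
    | all τ' ψ =>
      simp only [Fm.code, Nat.pair_eq_pair, true_and] at h
      obtain rfl := Ty.code_inj h.1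
      rw [ih h.2]
    | _ => simp [Fm.code] at h

theorem exists_enum : ∃ e : ℕ → Fm [], Function.Surjective e := by
  have : Countable (Fm []) := Function.Injective.countable fun _ _ h => Fm.code_inj h
  have : Nonempty (Fm []) := ⟨.bot⟩
  exact exists_surjective_nat _

/-! ### Henkin theories -/

/-- A complete theory containing the axioms, in which every false universal statement has a
counterexample. -/
structure Henkin (T : Fm [] → Prop) : Prop where
  ax : ∀ {φ}, Axm φ → T φ
  bot : ¬ T .bot
  imp : ∀ {φ ψ}, T (.imp φ ψ) ↔ (T φ → T ψ)
  all : ∀ {τ φ}, T (.all τ φ) ↔ ∀ t, T (φ.inst t)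

/-- One step of the Lindenbaum construction. Free variables play the role of Henkin constants; since
the list of hypotheses stays finite, an unused one is always available. -/
theorem exists_step (H : List (Fm [])) (hH : ¬ Prf H .bot) (ψ : Fm []) :
    ∃ H', H ⊆ H' ∧ ¬ Prf H' .bot ∧
      (ψ ∈ H' ∨ ψ.not ∈ H' ∧ ∀ τ χ, ψ = .all τ χ → ∃ t, (χ.inst t).not ∈ H') := by
  by_cases h : Prf (ψ :: H) .bot
  · have h' : ¬ Prf (ψ.not :: H) .bot := fun h' => hH (.impE (.impI h) (.raa h'))
    by_cases hψ : ∃ τ χ, ψ = .all τ χ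
    · obtain ⟨τ, χ, rfl⟩ := hψ
      obtain ⟨N₁, h₁⟩ := exists_fresh_list ((Fm.all τ χ).not :: H)
      obtain ⟨N₂, h₂⟩ := χ.exists_fresh
      refine ⟨(χ.inst (.fv τ (max N₁ N₂))).not :: (Fm.all τ χ).not :: H,
        fun _ h => by simp [h], fun hc => h' ?_, .inr ⟨by simp, fun τ' χ' h => ?_⟩⟩
      -- If the negated instance at a fresh variable were refutable, the instance would be provable
      -- and could be generalised, contradicting the negated universal formula.
      · exact .impE (.hyp List.mem_cons_self) (.allI (max N₁ N₂) (h₂ _ (le_max_right _ _) τ)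
          (h₁ _ (le_max_left _ _) τ) (.raa hc))
      · cases h
        exact ⟨_, List.mem_cons_self⟩
    · exact ⟨ψ.not :: H, fun _ h => by simp [h], h', .inr ⟨by simp, fun τ χ h => (hψ ⟨τ, χ, h⟩).elim⟩⟩
  · exact ⟨ψ :: H, fun _ h => by simp [h], h, .inl (by simp)⟩

/-- Starting from the negation of `φ`, stage `n` decides the `n`-th formula of an enumeration. The
union of the stages is complete, and it is deductively closed because a derivable formula cannot
have its negation in a later consistent stage. -/
theorem exists_henkin {φ : Fm []} (h : ¬ Provable φ) : ∃ T, Henkin T ∧ ¬ T φ := by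
  obtain ⟨e, he⟩ := exists_enum
  choose! step hs₁ hs₂ hs₃ using exists_step
  let Hs : ℕ → List (Fm []) := fun n => Nat.rec [φ.not] (fun k H => step H (e k)) n
  have con : ∀ n, ¬ Prf (Hs n) .bot := by
    intro n
    induction n with
    | zero => exact fun h' => h (.raa h')
    | succ n ih => exact hs₂ _ ih _
  have mono : Monotone fun n => {ψ | ψ ∈ Hs n} :=
    monotone_nat_of_le_succ fun n => hs₁ _ (con n) _
  let T : Fm [] → Prop := fun ψ => ∃ n, ψ ∈ Hs n
  have clash : ∀ ψ, T ψ → ¬ T ψ.not := by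
    rintro ψ ⟨n, hn⟩ ⟨m, hm⟩
    exact con (max n m) (.impE (.hyp (mono (le_max_right n m) hm)) (.hyp (mono (le_max_left n m) hn)))
  have dec : ∀ ψ, T ψ ∨ T ψ.not ∧ ∀ τ χ, ψ = .all τ χ → ∃ t, T (χ.inst t).not := by
    intro ψ
    obtain ⟨n, rfl⟩ := he ψ
    rcases hs₃ _ (con n) (e n) with h | ⟨h, h'⟩
    · exact .inl ⟨n + 1, h⟩
    · refine .inr ⟨⟨n + 1, h⟩, fun τ χ hχ => ?_⟩
      obtain ⟨t, ht⟩ := h' τ χ hχ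
      exact ⟨t, n + 1, ht⟩
  have closed : ∀ n ψ, Prf (Hs n) ψ → T ψ := by
    intro n ψ hn
    refine (dec ψ).resolve_right ?_
    rintro ⟨⟨m, hm⟩, -⟩
    exact con (max n m) (.impE (.hyp (mono (le_max_right n m) hm))
      (hn.weaken (mono (le_max_left n m))))
  refine ⟨T, ⟨fun h => closed 0 _ (.ax h), fun ⟨n, hn⟩ => con n (.hyp hn), ?_, ?_⟩,
    fun h => clash _ h ⟨0, by simp [Hs]⟩⟩
  · intro φ ψ
    constructor
    · rintro ⟨n, hn⟩ ⟨m, hm⟩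
      exact closed (max n m) _ (.impE (.hyp (mono (le_max_left n m) hn))
        (.hyp (mono (le_max_right n m) hm)))
    · intro h
      rcases dec φ with hφ | ⟨⟨n, hn⟩, -⟩
      · obtain ⟨n, hn⟩ := h hφ
        exact closed n _ (.impI (.hyp (by simp [hn])))
      · refine closed n _ (.impI (.raa (.impE (.hyp (φ := φ.not) ?_) (.hyp (φ := φ) ?_)))) <;> simp [hn]
  · intro τ φ
    constructor
    · rintro ⟨n, hn⟩ t
      exact closed n _ (.allE t (.hyp hn))
    · intro h
      refine (dec _).resolve_right ?_
      rintro ⟨-, h'⟩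
      obtain ⟨t, ht⟩ := h' τ φ rfl
      exact clash _ (h t) ht


/-! ### Structures and models -/

/-- An interpretation of the language, including the free variables. -/
structure Str where
  C : Ty → Type
  app : ∀ {σ τ : Ty}, C (σ ⇾ τ) → C σ → C τ
  fv : ∀ τ : Ty, ℕ → C τ
  zero : C Ty.nat
  succ : C (Ty.nat ⇾ Ty.nat)
  kc : ∀ σ τ : Ty, C (σ ⇾ τ ⇾ σ)
  sc : ∀ ρ σ τ : Ty, C ((ρ ⇾ σ ⇾ τ) ⇾ (ρ ⇾ σ) ⇾ ρ ⇾ τ)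
  rc : C (Ty.nat ⇾ Ty.nat ⇾ (Ty.nat ⇾ Ty.nat ⇾ Ty.nat) ⇾ Ty.nat)

/-- Assignments of values to the bound variables in scope. -/
abbrev Str.Env (M : Str) (Γ : Ctx) : Type := ∀ τ : Ty, Var Γ τ → M.C τ

def Str.nil (M : Str) : M.Env [] := fun _ x => nomatch x

def Str.Env.cons {M : Str} {Γ : Ctx} {σ : Ty} (a : M.C σ) (ρ : M.Env Γ) : M.Env (σ :: Γ)
  | _, .here => a
  | _, .there x => ρ _ x

theorem Str.Env.eq_nil {M : Str} (ρ : M.Env []) : ρ = M.nil := by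
  funext τ x
  nomatch x

/-- The value of a term. -/
def Str.eval (M : Str) {Γ : Ctx} (ρ : M.Env Γ) : {τ : Ty} → Tm Γ τ → M.C τ
  | _, .bv x => ρ _ x
  | _, .fv τ n => M.fv τ n
  | _, .zero => M.zero
  | _, .succ => M.succ
  | _, .kc σ τ => M.kc σ τ
  | _, .sc ρ σ τ => M.sc ρ σ τ
  | _, .rc => M.rc
  | _, .app s t => M.app (M.eval ρ s) (M.eval ρ t)

/-- Truth of a formula. -/
def Str.sat (M : Str) : {Γ : Ctx} → M.Env Γ → Fm Γ → Prop
  | _, ρ, .eq s t => M.eval ρ s = M.eval ρ t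
  | _, _, .bot => False
  | _, ρ, .imp φ ψ => M.sat ρ φ → M.sat ρ ψ
  | _, ρ, .all _ φ => ∀ a, M.sat (ρ.cons a) φ

/-- Extensional structures with named elements in which the axioms are true. -/
structure Model extends Str where
  ext : ∀ {σ τ : Ty} {f g : C (σ ⇾ τ)}, (∀ a, app f a = app g a) → f = g
  named : ∀ {τ : Ty} (a : C τ), ∃ t : Tm [] τ, toStr.eval toStr.nil t = a
  ax : ∀ {φ : Fm []}, Axm φ → toStr.sat toStr.nil φ

theorem Str.eval_rename (M : Str) {Γ Δ : Ctx} (r : ∀ τ : Ty, Var Γ τ → Var Δ τ) (ρ : M.Env Δ)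
    {τ : Ty} (t : Tm Γ τ) : M.eval ρ (t.rename r) = M.eval (fun τ x => ρ τ (r τ x)) t := by
  induction t <;> simp_all [Tm.rename, Str.eval]

theorem Str.eval_wk (M : Str) {Γ : Ctx} {σ τ : Ty} (a : M.C σ) (ρ : M.Env Γ) (t : Tm Γ τ) :
    M.eval (ρ.cons a) t.wk = M.eval ρ t := M.eval_rename _ _ t

theorem Str.eval_subst (M : Str) {Γ Δ : Ctx} (s : Sub Γ Δ) (ρ : M.Env Δ)
    {τ : Ty} (t : Tm Γ τ) : M.eval ρ (t.subst s) = M.eval (fun τ x => M.eval ρ (s τ x)) t := by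
  induction t <;> simp_all [Tm.subst, Str.eval]

theorem Str.eval_lift (M : Str) {Γ : Ctx} (ρ : M.Env Γ) {τ : Ty} (t : Tm [] τ) :
    M.eval ρ t.lift = M.eval M.nil t := by
  rw [Tm.lift, M.eval_subst, Str.Env.eq_nil fun τ x => _]

theorem Str.eval_cons (M : Str) {Γ Δ : Ctx} {σ : Ty} (t : Tm Δ σ) (s : Sub Γ Δ) (ρ : M.Env Δ) :
    (fun τ x => M.eval ρ (Sub.cons t s τ x)) =
      Str.Env.cons (M.eval ρ t) fun τ x => M.eval ρ (s τ x) := by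
  funext τ x
  cases x <;> rfl

theorem Str.sat_subst (M : Str) {Γ Δ : Ctx} (s : Sub Γ Δ) (ρ : M.Env Δ) (φ : Fm Γ) :
    M.sat ρ (φ.subst s) ↔ M.sat (fun τ x => M.eval ρ (s τ x)) φ := by
  induction φ generalizing Δ with
  | eq => simp [Fm.subst, Str.sat, M.eval_subst]
  | bot => rfl
  | imp _ _ h₁ h₂ => simp [Fm.subst, Str.sat, h₁, h₂]
  | all τ φ h =>
    simp only [Fm.subst, Str.sat, h]
    refine forall_congr' fun a => ?_
    rw [Sub.under, M.eval_cons]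
    simp only [M.eval_wk]
    rfl

theorem Str.sat_inst (M : Str) {Γ : Ctx} {σ : Ty} (ρ : M.Env Γ) (φ : Fm [σ]) (t : Tm Γ σ) :
    M.sat ρ (φ.inst t) ↔ M.sat (M.nil.cons (M.eval ρ t)) φ := by
  rw [Fm.inst, M.sat_subst, M.eval_cons, Str.Env.eq_nil fun τ x => _]

/-- Extensionality turns the defined pointwise equality into identity of elements, so equational
axioms of all types become equations in the model. -/
theorem Str.sat_eqT (M : Model) {Γ : Ctx} (ρ : M.Env Γ) (τ : Ty) (s t : Tm Γ τ) :
    M.sat ρ (Fm.eqT τ s t) ↔ M.eval ρ s = M.eval ρ t := by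
  induction τ generalizing Γ with
  | nat => rfl
  | arr σ τ _ h =>
    simp only [Fm.eqT, Str.sat, h, Str.eval, M.eval_wk]
    exact ⟨fun h => M.ext h, fun h a => by rw [h]⟩

/-! ### Composition of substitutions -/

theorem Tm.subst_rename {Γ Δ Θ : Ctx} (r : ∀ τ : Ty, Var Γ τ → Var Δ τ) (s : Sub Δ Θ)
    {τ : Ty} (t : Tm Γ τ) : (t.rename r).subst s = t.subst fun τ x => s τ (r τ x) := by
  induction t <;> simp_all [Tm.rename, Tm.subst]

theorem Tm.rename_subst {Γ Δ Θ : Ctx} (s : Sub Γ Δ) (r : ∀ τ : Ty, Var Δ τ → Var Θ τ)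
    {τ : Ty} (t : Tm Γ τ) : (t.subst s).rename r = t.subst fun τ x => (s τ x).rename r := by
  induction t <;> simp_all [Tm.rename, Tm.subst]

theorem Tm.subst_subst {Γ Δ Θ : Ctx} (s : Sub Γ Δ) (s' : Sub Δ Θ)
    {τ : Ty} (t : Tm Γ τ) : (t.subst s).subst s' = t.subst fun τ x => (s τ x).subst s' := by
  induction t <;> simp_all [Tm.subst]

theorem Tm.subst_bv {Γ : Ctx} {τ : Ty} (t : Tm Γ τ) : t.subst (fun _ x => .bv x) = t := by
  induction t <;> simp_all [Tm.subst]

theorem Tm.wk_subst_cons {Γ Δ : Ctx} {σ τ : Ty} (u : Tm Δ σ) (s : Sub Γ Δ) (t : Tm Γ τ) :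
    t.wk.subst (Sub.cons u s) = t.subst s := Tm.subst_rename _ _ t

theorem Tm.wk_subst_under {Γ Δ : Ctx} {σ τ : Ty} (s : Sub Γ Δ) (t : Tm Γ τ) :
    (t.wk (σ := σ)).subst s.under = (t.subst s).wk :=
  (Tm.subst_rename _ _ t).trans (Tm.rename_subst _ _ t).symm

theorem Fm.subst_subst {Γ Δ Θ : Ctx} (s : Sub Γ Δ) (s' : Sub Δ Θ) (φ : Fm Γ) :
    (φ.subst s).subst s' = φ.subst fun τ x => (s τ x).subst s' := by
  induction φ generalizing Δ Θ with
  | eq => simp [Fm.subst, Tm.subst_subst]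
  | bot => rfl
  | imp _ _ h₁ h₂ => simp [Fm.subst, h₁, h₂]
  | all τ φ h =>
    simp only [Fm.subst, h]
    congr 2
    funext τ x
    cases x with
    | here => rfl
    | there x => exact Tm.wk_subst_under s' _

theorem Sub.under_bv {Γ : Ctx} {σ : Ty} :
    Sub.under (σ := σ) (fun τ x => (.bv x : Tm Γ τ)) = fun _ x => .bv x := by
  funext τ x
  cases x <;> rfl

theorem Fm.subst_bv {Γ : Ctx} (φ : Fm Γ) : φ.subst (fun _ x => .bv x) = φ := by
  induction φ with
  | all τ φ h => simp [Fm.subst, Sub.under_bv, h]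
  | _ => simp_all [Fm.subst, Tm.subst_bv]

theorem Fm.subst_nil (φ : Fm []) : φ.subst Sub.nil = φ := by
  rw [Sub.nil_ext Sub.nil fun _ x => .bv x, Fm.subst_bv]

theorem Fm.subst_under_inst {Γ : Ctx} {σ : Ty} (s : Sub Γ []) (φ : Fm (σ :: Γ)) (t : Tm [] σ) :
    (φ.subst s.under).inst t = φ.subst (Sub.cons t s) := by
  rw [Fm.inst, Fm.subst_subst]
  congr 1
  funext τ x
  cases x with
  | here => rfl
  | there x =>
    refine (Tm.wk_subst_cons _ _ _).trans ?_
    rw [Sub.nil_ext Sub.nil fun _ x => .bv x, Tm.subst_bv]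
    rfl

theorem Fm.eqT_subst {Γ Δ : Ctx} (s : Sub Γ Δ) (τ : Ty) (t u : Tm Γ τ) :
    (Fm.eqT τ t u).subst s = Fm.eqT τ (t.subst s) (u.subst s) := by
  induction τ generalizing Γ Δ with
  | nat => rfl
  | arr σ τ _ h =>
    simp only [Fm.eqT, Fm.subst, h, Tm.subst, Tm.wk_subst_under]
    rfl

/-! ### The term model and completeness -/

namespace Henkin

theorem eqT_arr {T : Fm [] → Prop} (hT : Henkin T) {σ τ : Ty} {s t : Tm [] (σ ⇾ τ)} :
    T (Fm.eqT (σ ⇾ τ) s t) ↔ ∀ u, T (Fm.eqT τ (s ⬝ u) (t ⬝ u)) := by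
  rw [Fm.eqT, hT.all]
  refine forall_congr' fun u => ?_
  rw [Fm.inst, Fm.eqT_subst]
  simp only [Tm.subst, Tm.wk_subst_cons]
  rw [Sub.nil_ext Sub.nil fun _ x => .bv x, Tm.subst_bv, Tm.subst_bv]
  rfl

theorem eqT_equivalence {T : Fm [] → Prop} (hT : Henkin T) (τ : Ty) : Equivalence fun s t : Tm [] τ => T (Fm.eqT τ s t) := by
  induction τ with
  | nat =>
    exact ⟨fun s => hT.ax (.eq_refl s), fun h => hT.imp.1 (hT.ax (.eq_symm _ _)) h,
      fun h h' => hT.imp.1 (hT.imp.1 (hT.ax (.eq_trans _ _ _)) h) h'⟩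
  | arr σ τ _ h =>
    simp only [hT.eqT_arr]
    exact ⟨fun s u => h.refl _, fun h' u => h.symm (h' u), fun h₁ h₂ u => h.trans (h₁ u) (h₂ u)⟩

variable {T : Fm [] → Prop} (hT : Henkin T)

/-- Provable equality. -/
def setoid (τ : Ty) : Setoid (Tm [] τ) := ⟨_, hT.eqT_equivalence τ⟩

/-- The term model. -/
def str : Str where
  C τ := Quotient (hT.setoid τ)
  app {σ τ} := Quotient.lift₂ (fun s t => Quotient.mk (hT.setoid τ) (s ⬝ t)) <| by
    intro s t s' t' hs ht
    -- Changing the function is harmless because higher equality is pointwise; changing the argument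
    -- is harmless by the axiom of extensionality.
    refine Quotient.sound ((hT.eqT_equivalence τ).trans (hT.eqT_arr.1 hs t) ?_)
    exact hT.imp.1 (hT.ax (.ext _ _ _ _ _)) ht
  fv τ n := Quotient.mk _ (.fv τ n)
  zero := Quotient.mk _ .zero
  succ := Quotient.mk _ .succ
  kc σ τ := Quotient.mk _ (.kc σ τ)
  sc ρ σ τ := Quotient.mk _ (.sc ρ σ τ)
  rc := Quotient.mk _ .rc

theorem eval_str {Γ : Ctx} (s : Sub Γ []) {τ : Ty} (t : Tm Γ τ) :
    hT.str.eval (fun τ x => Quotient.mk (hT.setoid τ) (s τ x)) t =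
      Quotient.mk (hT.setoid τ) (t.subst s) := by
  induction t with
  | app t u h₁ h₂ =>
    simp only [Str.eval, h₁, h₂]
    rfl
  | _ => rfl

/-- The truth lemma. At a quantifier, every element is the class of a term, and the Henkin property
reduces a universal formula to its term instances. -/
theorem sat_str {Γ : Ctx} (s : Sub Γ []) (φ : Fm Γ) :
    hT.str.sat (fun τ x => Quotient.mk (hT.setoid τ) (s τ x)) φ ↔ T (φ.subst s) := by
  induction φ with
  | eq t u =>
    simp only [Str.sat, hT.eval_str]
    exact Quotient.eq
  | bot => exact ⟨False.elim, hT.bot⟩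
  | imp φ ψ h₁ h₂ => simp only [Str.sat, h₁, h₂, Fm.subst, hT.imp]
  | all τ φ h =>
    simp only [Str.sat, Fm.subst, hT.all, Fm.subst_under_inst, ← h]
    have key : ∀ t : Tm [] τ, Str.Env.cons (M := hT.str) (Quotient.mk (hT.setoid τ) t)
        (fun τ x => Quotient.mk (hT.setoid τ) (s τ x)) =
          fun σ x => Quotient.mk (hT.setoid σ) (Sub.cons t s σ x) := by
      intro t
      funext σ x
      cases x <;> rfl
    constructor
    · intro h t
      rw [← key]
      exact h _
    · rintro h ⟨t⟩
      exact (key t).symm ▸ h t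

theorem sat_str_nil (φ : Fm []) : hT.str.sat hT.str.nil φ ↔ T φ := by
  rw [← Str.Env.eq_nil fun τ x => Quotient.mk (hT.setoid τ) (Sub.nil τ x), hT.sat_str,
    Fm.subst_nil]

/-- The term model is a model. -/
def model : Model where
  toStr := hT.str
  ext {σ τ f g} := by
    induction f using Quotient.inductionOn
    induction g using Quotient.inductionOn
    intro h
    refine Quotient.sound (hT.eqT_arr.2 fun u => ?_)
    exact Quotient.exact (h (Quotient.mk _ u))
  named {τ a} := by
    induction a using Quotient.inductionOn with | h t
    refine ⟨t, ?_⟩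
    rw [← Str.Env.eq_nil fun τ x => Quotient.mk (hT.setoid τ) (Sub.nil τ x), hT.eval_str,
      Sub.nil_ext Sub.nil fun _ x => .bv x, Tm.subst_bv]
  ax h := (hT.sat_str_nil _).2 (hT.ax h)

end Henkin

/-- Completeness: sentences true in all models are provable. -/
theorem provable_of_sat {φ : Fm []} (h : ∀ M : Model, M.sat M.nil φ) : Provable φ := by
  by_contra hφ
  obtain ⟨T, hT, hn⟩ := exists_henkin hφ
  exact hn ((hT.sat_str_nil φ).1 (h hT.model))


/-! ### Abstraction -/

/-- Bracket abstraction. -/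
def Tm.lam {Γ : Ctx} {σ : Ty} : {τ : Ty} → Tm (σ :: Γ) τ → Tm Γ (σ ⇾ τ)
  -- The identity as `Σ Π Π`; the intermediate type is arbitrary, here built from `nat`.
  | _, .bv .here => .sc σ (Ty.nat ⇾ σ) σ ⬝ .kc _ _ ⬝ .kc _ _
  | _, .bv (.there x) => .kc _ _ ⬝ .bv x
  | _, .fv τ n => .kc _ _ ⬝ .fv τ n
  | _, .zero => .kc _ _ ⬝ .zero
  | _, .succ => .kc _ _ ⬝ .succ
  | _, .kc ρ τ => .kc _ _ ⬝ .kc ρ τ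
  | _, .sc π ρ τ => .kc _ _ ⬝ .sc π ρ τ
  | _, .rc => .kc _ _ ⬝ .rc
  | _, .app s t => .sc _ _ _ ⬝ s.lam ⬝ t.lam

@[simp] theorem Tm.fresh_lam {τ : Ty} {n : ℕ} : {Γ : Ctx} → {ρ σ : Ty} → (t : Tm (σ :: Γ) ρ) →
    (t.lam.Fresh τ n ↔ t.Fresh τ n)
  | _, _, _, .bv .here => by simp [Tm.lam, Tm.Fresh]
  | _, _, _, .bv (.there x) => by simp [Tm.lam, Tm.Fresh]
  | _, _, _, .fv τ n => by simp [Tm.lam, Tm.Fresh]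
  | _, _, _, .zero => by simp [Tm.lam, Tm.Fresh]
  | _, _, _, .succ => by simp [Tm.lam, Tm.Fresh]
  | _, _, _, .kc ρ τ => by simp [Tm.lam, Tm.Fresh]
  | _, _, _, .sc π ρ τ => by simp [Tm.lam, Tm.Fresh]
  | _, _, _, .rc => by simp [Tm.lam, Tm.Fresh]
  | _, _, _, .app s t => by simp [Tm.lam, Tm.Fresh, fresh_lam s, fresh_lam t]

@[simp] theorem Tm.fresh_lift {τ σ : Ty} {n : ℕ} {Γ : Ctx} (t : Tm [] σ) :
    (t.lift : Tm Γ σ).Fresh τ n ↔ t.Fresh τ n := by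
  have : ∀ {Δ : Ctx} (hΔ : Δ = []) {σ : Ty} (t : Tm Δ σ) (s : Sub Δ Γ),
      (t.subst s).Fresh τ n ↔ t.Fresh τ n := by
    intro Δ hΔ σ t s
    induction t with
    | bv x => subst hΔ; nomatch x
    | app t u h₁ h₂ => simp [Tm.subst, h₁, h₂]
    | _ => simp [Tm.subst, Tm.Fresh]
  exact this rfl t _

@[simp] theorem Tm.fresh_wk {τ σ ρ : Ty} {n : ℕ} {Γ : Ctx} (t : Tm Γ σ) :
    (t.wk (σ := ρ)).Fresh τ n ↔ t.Fresh τ n := by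
  have : ∀ {Γ Δ : Ctx} {σ : Ty} (t : Tm Γ σ) (r : ∀ τ : Ty, Var Γ τ → Var Δ τ),
      (t.rename r).Fresh τ n ↔ t.Fresh τ n := by
    intro Γ Δ σ t r
    induction t with
    | app t u h₁ h₂ => simp [Tm.rename, h₁, h₂]
    | _ => simp [Tm.rename, Tm.Fresh]
  exact this t _

@[simp] theorem Str.eval_app {M : Str} {Γ : Ctx} (ρ : M.Env Γ) {σ τ : Ty} (s : Tm Γ (σ ⇾ τ))
    (t : Tm Γ σ) : M.eval ρ (s ⬝ t) = M.app (M.eval ρ s) (M.eval ρ t) := rfl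

namespace Model

variable {M : Model}

-- The axioms speak of terms. As every element is named by a term, they become laws about all
-- elements; the other axioms are transferred in the same way.
@[simp] theorem kc_app {σ τ : Ty} (a : M.C σ) (b : M.C τ) : M.app (M.app (M.kc σ τ) a) b = a := by
  obtain ⟨s, rfl⟩ := M.named a
  obtain ⟨t, rfl⟩ := M.named b
  exact (Str.sat_eqT M _ _ _ _).1 (M.ax (.kc_eq σ τ s t))

@[simp] theorem sc_app {ρ σ τ : Ty} (a : M.C (ρ ⇾ σ ⇾ τ)) (b : M.C (ρ ⇾ σ)) (c : M.C ρ) :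
    M.app (M.app (M.app (M.sc ρ σ τ) a) b) c = M.app (M.app a c) (M.app b c) := by
  obtain ⟨r, rfl⟩ := M.named a
  obtain ⟨s, rfl⟩ := M.named b
  obtain ⟨t, rfl⟩ := M.named c
  exact (Str.sat_eqT M _ _ _ _).1 (M.ax (.sc_eq ρ σ τ r s t))

@[simp] theorem eval_lam {Γ : Ctx} (ρ : M.Env Γ) {σ : Ty} (a : M.C σ) :
    {τ : Ty} → (t : Tm (σ :: Γ) τ) → M.app (M.eval ρ t.lam) a = M.eval (ρ.cons a) t
  | _, .bv .here => (sc_app _ _ _).trans (kc_app _ _)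
  | _, .bv (.there x) => kc_app _ _
  | _, .fv τ n => kc_app _ _
  | _, .zero => kc_app _ _
  | _, .succ => kc_app _ _
  | _, .kc ρ τ => kc_app _ _
  | _, .sc π ρ τ => kc_app _ _
  | _, .rc => kc_app _ _
  | _, .app s t => by
    rw [Tm.lam, Str.eval_app, Str.eval_app, Str.eval, sc_app, eval_lam ρ a s, eval_lam ρ a t]
    rfl

/-! ### Arithmetic in a model -/

instance : Zero (M.C .nat) := ⟨M.zero⟩
instance : One (M.C .nat) := ⟨M.app M.succ M.zero⟩
instance : Add (M.C .nat) :=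
  ⟨fun a b => M.app (M.app (M.app M.rc b) a) (M.eval M.nil stepSucc)⟩
instance : Mul (M.C .nat) :=
  ⟨fun a b => M.app (M.app (M.app M.rc b) 0) (M.eval (M.nil.cons a) (stepAdd v0))⟩

theorem zero_eq : M.zero = 0 := rfl

@[simp] theorem rc_zero (y : M.C .nat) (z) : M.app (M.app (M.app M.rc 0) y) z = y := by
  obtain ⟨s, rfl⟩ := M.named y
  obtain ⟨t, rfl⟩ := M.named z
  exact M.ax (.rc_zero s t)

theorem rc_succ' (x y : M.C .nat) (z) : M.app (M.app (M.app M.rc (M.app M.succ x)) y) z =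
    M.app (M.app z (M.app (M.app (M.app M.rc x) y) z)) x := by
  obtain ⟨r, rfl⟩ := M.named x
  obtain ⟨s, rfl⟩ := M.named y
  obtain ⟨t, rfl⟩ := M.named z
  exact M.ax (.rc_succ r s t)

theorem stepSucc_app {Γ : Ctx} (ρ : M.Env Γ) (a b : M.C .nat) :
    M.app (M.app (M.eval ρ stepSucc) a) b = M.app M.succ a := by
  simp [stepSucc, Str.eval]

@[simp] theorem succ_app (x : M.C .nat) : M.app M.succ x = x + 1 := by
  change _ = M.app (M.app (M.app M.rc (M.app M.succ 0)) x) _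
  rw [rc_succ', stepSucc_app, rc_zero]

@[simp] theorem rc_succ (x y : M.C .nat) (z) : M.app (M.app (M.app M.rc (x + 1)) y) z =
    M.app (M.app z (M.app (M.app (M.app M.rc x) y) z)) x := by
  rw [← succ_app, rc_succ']

theorem succ_ne (x : M.C .nat) : x + 1 ≠ 0 := by
  obtain ⟨r, rfl⟩ := M.named x
  rw [← succ_app]
  exact M.ax (.succ_ne_zero r)

theorem succ_inj {x y : M.C .nat} (h : x + 1 = y + 1) : x = y := by
  obtain ⟨r, rfl⟩ := M.named x
  obtain ⟨s, rfl⟩ := M.named y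
  rw [← succ_app, ← succ_app] at h
  exact M.ax (.succ_inj r s) h

/-! ### Induction -/

/-- The function is an element of the model. -/
def Rep {σ τ : Ty} (f : M.C σ → M.C τ) : Prop := ∃ F : M.C (σ ⇾ τ), ∀ a, M.app F a = f a

theorem Rep.app {ρ σ τ : Ty} {f : M.C ρ → M.C (σ ⇾ τ)} {g : M.C ρ → M.C σ} (hf : Rep f)
    (hg : Rep g) : Rep fun a => M.app (f a) (g a) := by
  obtain ⟨F, hF⟩ := hf
  obtain ⟨G, hG⟩ := hg
  exact ⟨M.app (M.app (M.sc _ _ _) F) G, fun a => by simp [hF, hG]⟩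

theorem Rep.const {σ τ : Ty} (b : M.C τ) : Rep fun _ : M.C σ => b :=
  ⟨M.app (M.kc _ _) b, fun a => by simp⟩

theorem Rep.id {σ : Ty} : Rep fun a : M.C σ => a :=
  ⟨M.eval M.nil (Tm.lam v0), fun _ => eval_lam _ _ _⟩

theorem Rep.comp {ρ σ τ : Ty} {f : M.C σ → M.C τ} {g : M.C ρ → M.C σ} (hf : Rep f)
    (hg : Rep g) : Rep fun a => f (g a) := by
  obtain ⟨F, hF⟩ := hf
  simp only [← hF]
  exact (Rep.const F).app hg

theorem Rep.eval {Γ : Ctx} (ρ : M.Env Γ) {σ τ : Ty} (t : Tm (σ :: Γ) τ) :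
    Rep fun a : M.C σ => M.eval (ρ.cons a) t := ⟨M.eval ρ t.lam, fun a => by simp⟩

/-- The predicate is defined by a quantifier-free formula. -/
def Dec (P : M.C .nat → Prop) : Prop :=
  ∃ φ : Fm [Ty.nat], φ.QF ∧ ∀ x, M.sat (M.nil.cons x) φ ↔ P x

/-- Parameters of any type may occur: naming `F` and `G` by terms absorbs them into a
quantifier-free formula in one number variable. -/
theorem Dec.eq {f g : M.C .nat → M.C .nat} (hf : Rep f) (hg : Rep g) :
    Dec fun x => f x = g x := by
  obtain ⟨F, hF⟩ := hf
  obtain ⟨G, hG⟩ := hg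
  obtain ⟨s, rfl⟩ := M.named F
  obtain ⟨t, rfl⟩ := M.named G
  refine ⟨.eq (s.lift ⬝ v0) (t.lift ⬝ v0), trivial, fun x => ?_⟩
  simp only [← hF, ← hG, Str.sat, Str.eval_app, Str.eval_lift]
  rfl

theorem Dec.imp {P Q : M.C .nat → Prop} (hP : Dec P) (hQ : Dec Q) : Dec fun x => P x → Q x := by
  obtain ⟨φ, h, hφ⟩ := hP
  obtain ⟨ψ, h', hψ⟩ := hQ
  exact ⟨.imp φ ψ, ⟨h, h'⟩, fun x => by simp [Str.sat, hφ, hψ]⟩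

theorem Dec.not {P : M.C .nat → Prop} (hP : Dec P) : Dec fun x => ¬ P x := by
  obtain ⟨φ, h, hφ⟩ := hP
  exact ⟨.imp φ .bot, ⟨h, trivial⟩, fun x => by simp [Str.sat, hφ]⟩

theorem Dec.or {P Q : M.C .nat → Prop} (hP : Dec P) (hQ : Dec Q) : Dec fun x => P x ∨ Q x := by
  simp only [or_iff_not_imp_left]
  exact hP.not.imp hQ

theorem ind {P : M.C .nat → Prop} (hP : Dec P) (h0 : P 0) (h1 : ∀ x, P x → P (x + 1))
    (x : M.C .nat) : P x := by
  obtain ⟨φ, hφ, h⟩ := hP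
  have := M.ax (.qf_ind φ hφ)
  simp only [Str.sat, Str.sat_inst, h, Str.eval_app] at this
  refine this h0 (fun x hx => ?_) x
  have := h1 x hx
  rwa [← succ_app] at this

theorem Rep.add {σ : Ty} {f g : M.C σ → M.C .nat} (hf : Rep f) (hg : Rep g) :
    Rep fun x => f x + g x := (((Rep.const _).app hg).app hf).app (.const _)

theorem stepAdd_app {Γ : Ctx} (ρ : M.Env Γ) (s : Tm Γ Ty.nat) (a b : M.C .nat) :
    M.app (M.app (M.eval ρ (stepAdd s)) a) b = a + M.eval ρ s := by
  have : M.eval ρ stepSucc = M.eval M.nil stepSucc := rfl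
  simp [stepAdd, Str.eval, this]
  rfl

@[simp] theorem eval_add {Γ : Ctx} (ρ : M.Env Γ) (s t : Tm Γ Ty.nat) :
    M.eval ρ (s.add t) = M.eval ρ s + M.eval ρ t := rfl

theorem Rep.mul {f g : M.C .nat → M.C .nat} (hf : Rep f) (hg : Rep g) :
    Rep fun x => f x * g x :=
  ((Rep.const _).app hg).app (.const _) |>.app (Rep.comp (Rep.eval M.nil (stepAdd v0)) hf)

theorem nat_add_zero (a : M.C .nat) : a + 0 = a := rc_zero _ _

theorem nat_add_succ (a b : M.C .nat) : a + (b + 1) = a + b + 1 :=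
  (rc_succ _ _ _).trans ((stepSucc_app _ _ _).trans (succ_app _))

theorem nat_mul_zero (a : M.C .nat) : a * 0 = 0 := rc_zero _ _

theorem nat_mul_succ (a b : M.C .nat) : a * (b + 1) = a * b + a :=
  (rc_succ _ _ _).trans (stepAdd_app _ _ _ _)

theorem nat_zero_add (a : M.C .nat) : 0 + a = a := by
  induction a using ind with
  | hP => exact .eq (.add (.const _) .id) .id
  | h0 => exact nat_add_zero _
  | h1 x h => rw [nat_add_succ, h]

theorem nat_succ_add (a b : M.C .nat) : a + 1 + b = a + b + 1 := by
  induction b using ind with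
  | hP => exact .eq (.add (.const _) .id) (.add (.add (.const _) .id) (.const _))
  | h0 => simp only [nat_add_zero]
  | h1 x h => simp only [nat_add_succ, h]

theorem nat_add_comm (a b : M.C .nat) : a + b = b + a := by
  induction b using ind with
  | hP => exact .eq (.add (.const _) .id) (.add .id (.const _))
  | h0 => rw [nat_add_zero, nat_zero_add]
  | h1 x h => rw [nat_add_succ, h, nat_succ_add]

theorem nat_add_assoc (a b c : M.C .nat) : a + b + c = a + (b + c) := by
  induction c using ind with
  | hP => exact .eq (.add (.const _) .id) (.add (.const _) (.add (.const _) .id))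
  | h0 => simp only [nat_add_zero]
  | h1 x h => simp only [nat_add_succ, h]

theorem nat_zero_mul (a : M.C .nat) : 0 * a = 0 := by
  induction a using ind with
  | hP => exact .eq (.mul (.const _) .id) (.const _)
  | h0 => exact nat_mul_zero _
  | h1 x h => rw [nat_mul_succ, h, nat_add_zero]

theorem nat_succ_mul (a b : M.C .nat) : (a + 1) * b = a * b + b := by
  induction b using ind with
  | hP => exact .eq (.mul (.const _) .id) (.add (.mul (.const _) .id) .id)
  | h0 => simp only [nat_mul_zero, nat_add_zero]
  | h1 x h => rw [nat_mul_succ, h, nat_mul_succ, nat_add_assoc, nat_add_assoc, nat_add_succ,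
      nat_add_succ, nat_add_comm x a, nat_add_succ, nat_add_succ]

theorem nat_mul_comm (a b : M.C .nat) : a * b = b * a := by
  induction b using ind with
  | hP => exact .eq (.mul (.const _) .id) (.mul .id (.const _))
  | h0 => rw [nat_mul_zero, nat_zero_mul]
  | h1 x h => rw [nat_mul_succ, h, nat_succ_mul]

theorem nat_mul_add (a b c : M.C .nat) : a * (b + c) = a * b + a * c := by
  induction c using ind with
  | hP => exact .eq (.mul (.const _) (.add (.const _) .id)) (.add (.const _) (.mul (.const _) .id))
  | h0 => simp only [nat_add_zero, nat_mul_zero]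
  | h1 x h => rw [nat_add_succ, nat_mul_succ, h, nat_mul_succ, nat_add_assoc]

theorem nat_mul_assoc (a b c : M.C .nat) : a * b * c = a * (b * c) := by
  induction c using ind with
  | hP => exact .eq (.mul (.const _) .id) (.mul (.const _) (.mul (.const _) .id))
  | h0 => simp only [nat_mul_zero]
  | h1 x h => rw [nat_mul_succ, h, nat_mul_succ, nat_mul_add]

/-- Makes `ring` available for the possibly nonstandard numbers of the model. -/
instance : CommSemiring (M.C .nat) where
  add_assoc := nat_add_assoc
  zero_add := nat_zero_add
  add_zero := nat_add_zero
  add_comm := nat_add_comm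
  mul_assoc := nat_mul_assoc
  one_mul a := by rw [← nat_zero_add 1, nat_succ_mul, nat_zero_mul, nat_zero_add]
  mul_one a := by rw [← nat_zero_add 1, nat_mul_succ, nat_mul_zero, nat_zero_add]
  zero_mul := nat_zero_mul
  mul_zero := nat_mul_zero
  mul_comm := nat_mul_comm
  left_distrib := nat_mul_add
  right_distrib a b c := by rw [nat_mul_comm, nat_mul_add, nat_mul_comm c, nat_mul_comm c]
  nsmul := nsmulRec
  npow := npowRec

end Model


/-! ### Subtraction, order, and bounded search -/

/-- The predecessor. -/
def predT : Tm [] (.nat ⇾ .nat) := .lam (.rc ⬝ v0 ⬝ .zero ⬝ .lam (.lam v0))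

/-- Cut-off subtraction. -/
def subT : Tm [] (.nat ⇾ .nat ⇾ .nat) :=
  .lam (.lam (.rc ⬝ v0 ⬝ v1 ⬝ (Tm.lam (.lam (predT.lift ⬝ v1))).lift))

/-- Definition by cases: `s` if `c = 0`, and `t` otherwise. -/
def Tm.ite {Γ : Ctx} (c s t : Tm Γ .nat) : Tm Γ .nat := .rc ⬝ c ⬝ s ⬝ (.kc _ _ ⬝ (.kc _ _ ⬝ t))

/-- Bounded search: the least `x < n` with `f x = 0` if there is one, and `n` otherwise. -/
def searchT : Tm [] (.one ⇾ .nat ⇾ .nat) :=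
  .lam (.lam (.rc ⬝ v0 ⬝ .zero ⬝
    ((Tm.lam (.lam (.lam (.ite (v2 ⬝ v1) v1 (.succ ⬝ v0))))).lift ⬝ v1)))

namespace Model

variable {M : Model}

instance : _root_.Sub (M.C .nat) := ⟨fun a b => M.app (M.app (M.eval M.nil subT) a) b⟩

theorem pred_zero : M.app (M.eval M.nil predT) 0 = 0 := by
  simp [predT, Str.eval, Str.Env.cons, zero_eq]

theorem pred_succ (a : M.C .nat) : M.app (M.eval M.nil predT) (a + 1) = a := by
  simp [predT, Str.eval, Str.Env.cons]

theorem nat_sub_zero (a : M.C .nat) : a - 0 = a := by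
  change M.app (M.app (M.eval M.nil subT) a) 0 = _
  simp [subT, Str.eval, Str.Env.cons]

theorem nat_sub_succ (a b : M.C .nat) : a - (b + 1) = M.app (M.eval M.nil predT) (a - b) := by
  change M.app (M.app (M.eval M.nil subT) a) (b + 1) =
    M.app _ (M.app (M.app (M.eval M.nil subT) a) b)
  simp [subT, Str.eval, Str.Env.cons, Str.eval_lift]

theorem Rep.sub {σ : Ty} {f g : M.C σ → M.C .nat} (hf : Rep f) (hg : Rep g) :
    Rep fun x => f x - g x := ((Rep.const _).app hf).app hg

theorem eq_zero_or_succ (a : M.C .nat) : a = 0 ∨ ∃ b, a = b + 1 := by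
  -- An existential statement is not open to quantifier-free induction, so the witness is given
  -- explicitly by the predecessor.
  suffices h : a = 0 ∨ a = M.app (M.eval M.nil predT) a + 1 from h.imp_right fun h => ⟨_, h⟩
  induction a using ind with
  | hP => exact .or (.eq .id (.const _)) (.eq .id (.add (.app (.const _) .id) (.const _)))
  | h0 => exact .inl rfl
  | h1 x _ => exact .inr (by rw [pred_succ])

theorem nat_succ_sub_succ (a b : M.C .nat) : a + 1 - (b + 1) = a - b := by
  induction b using ind with
  | hP => exact .eq (.sub (.const _) (.add .id (.const _))) (.sub (.const _) .id)
  | h0 => rw [nat_sub_succ, nat_sub_zero, nat_sub_zero, pred_succ]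
  | h1 x h => rw [nat_sub_succ, h, nat_sub_succ]

theorem nat_add_sub_cancel (a b : M.C .nat) : b + a - b = a := by
  induction b using ind with
  | hP => exact .eq (.sub (.add .id (.const _)) .id) (.const _)
  | h0 => rw [zero_add, nat_sub_zero]
  | h1 x h => rw [add_right_comm, nat_succ_sub_succ, h]

theorem nat_zero_sub (a : M.C .nat) : 0 - a = 0 := by
  induction a using ind with
  | hP => exact .eq (.sub (.const _) .id) (.const _)
  | h0 => rw [nat_sub_zero]
  | h1 x h => rw [nat_sub_succ, h, pred_zero]

theorem nat_sub_add (a b : M.C .nat) : a - (a + b) = 0 := by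
  induction a using ind with
  | hP => exact .eq (.sub .id (.add .id (.const _))) (.const _)
  | h0 => rw [nat_zero_sub]
  | h1 x h => rw [add_right_comm, nat_succ_sub_succ, h]

theorem nat_add_left_cancel {a b c : M.C .nat} (h : a + b = a + c) : b = c := by
  rw [← nat_add_sub_cancel b a, h, nat_add_sub_cancel]

theorem nat_eq_zero_of_add {a b : M.C .nat} (h : a + b = 0) : b = 0 := by
  rcases eq_zero_or_succ b with rfl | ⟨c, rfl⟩
  · rfl
  · exact (succ_ne _ ((add_assoc a c 1).trans h)).elim

theorem nat_total (a b : M.C .nat) : (∃ c, b = a + c) ∨ ∃ c, a = b + c := by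
  -- Cut-off subtraction supplies the witnesses, which makes the disjunction quantifier-free.
  suffices h : b = a + (b - a) ∨ a = b + (a - b) from h.imp (fun h => ⟨_, h⟩) fun h => ⟨_, h⟩
  induction a using ind with
  | hP =>
    exact .or (.eq (.const _) (.add .id (.sub (.const _) .id)))
      (.eq .id (.add (.const _) (.sub .id (.const _))))
  | h0 => exact .inl (by rw [nat_sub_zero, zero_add])
  | h1 x h =>
    rcases h with h | h
    · rcases eq_zero_or_succ (b - x) with h' | ⟨c, h'⟩
      · rw [h', add_zero] at h
        subst h
        exact .inr (by rw [nat_add_sub_cancel])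
      · rw [h'] at h
        subst h
        exact .inl (by
          rw [show x + (c + 1) = x + 1 + c by ring, nat_add_sub_cancel])
    · generalize x - b = c at h
      subst h
      exact .inr (by rw [add_assoc, nat_add_sub_cancel])

open Classical in
noncomputable instance : LinearOrder (M.C .nat) where
  le a b := ∃ c, b = a + c
  le_refl a := ⟨0, (add_zero a).symm⟩
  le_trans := by
    rintro a _ _ ⟨c, rfl⟩ ⟨d, rfl⟩
    exact ⟨c + d, add_assoc _ _ _⟩
  le_antisymm := by
    rintro a _ ⟨c, rfl⟩ ⟨d, h⟩
    rw [add_assoc] at h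
    rw [add_comm c d] at h
    rw [nat_eq_zero_of_add (nat_add_left_cancel (h.symm.trans (add_zero a).symm)), add_zero]
  le_total a b := nat_total a b
  toDecidableLE := Classical.decRel _

theorem le_def {a b : M.C .nat} : a ≤ b ↔ ∃ c, b = a + c := Iff.rfl

theorem lt_def {a b : M.C .nat} : a < b ↔ ∃ c, a + (c + 1) = b := by
  rw [lt_iff_le_and_ne, le_def]
  constructor
  · rintro ⟨⟨c, rfl⟩, h⟩
    rcases eq_zero_or_succ c with rfl | ⟨d, rfl⟩
    · simp at h
    · exact ⟨d, rfl⟩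
  · rintro ⟨c, rfl⟩
    refine ⟨⟨_, rfl⟩, fun h => succ_ne c ?_⟩
    exact nat_add_left_cancel (h.symm.trans (add_zero a).symm)

instance : IsStrictOrderedRing (M.C .nat) where
  add_le_add_left := by
    rintro a _ ⟨c, rfl⟩ b
    exact ⟨c, by ring⟩
  le_of_add_le_add_left := by
    rintro a b c ⟨d, h⟩
    exact ⟨d, nat_add_left_cancel (h.trans (add_assoc _ _ _))⟩
  mul_lt_mul_of_pos_left := by
    intro a ha b c h
    rw [lt_def] at *
    obtain ⟨d, rfl⟩ := h
    obtain ⟨e, rfl⟩ := ha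
    exact ⟨e * d + d + e, by ring⟩
  mul_lt_mul_of_pos_right := by
    intro a ha b c h
    rw [lt_def] at *
    obtain ⟨d, rfl⟩ := h
    obtain ⟨e, rfl⟩ := ha
    exact ⟨e * d + d + e, by ring⟩
  zero_le_one := ⟨1, (zero_add _).symm⟩
  exists_pair_ne := ⟨0, 1, fun h => succ_ne 0 ((zero_add _).trans h.symm)⟩

theorem nat_zero_le (a : M.C .nat) : 0 ≤ a := ⟨a, (zero_add a).symm⟩

theorem nat_lt_iff {a b : M.C .nat} : a < b ↔ a + 1 ≤ b := by
  rw [lt_def, le_def]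
  exact exists_congr fun c => by rw [eq_comm, add_comm c, add_assoc]

theorem nat_lt_succ {a b : M.C .nat} : a < b + 1 ↔ a ≤ b := by
  rw [nat_lt_iff, add_le_add_iff_right]

theorem nat_sub_eq_zero {a b : M.C .nat} : a - b = 0 ↔ a ≤ b := by
  constructor
  · intro h
    rcases le_total a b with h' | ⟨c, rfl⟩
    · exact h'
    · rw [nat_add_sub_cancel] at h
      rw [h, add_zero]
  · rintro ⟨c, rfl⟩
    exact nat_sub_add _ _

theorem nat_add_eq_zero {a b : M.C .nat} : a + b = 0 ↔ a = 0 ∧ b = 0 :=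
  add_eq_zero_iff_of_nonneg (nat_zero_le a) (nat_zero_le b)

open Classical in
@[simp] theorem eval_ite {Γ : Ctx} (ρ : M.Env Γ) (c s t : Tm Γ .nat) : M.eval ρ (.ite c s t) =
    if M.eval ρ c = 0 then M.eval ρ s else M.eval ρ t := by
  simp only [Tm.ite, Str.eval]
  rcases eq_zero_or_succ (M.eval ρ c) with h | ⟨b, h⟩ <;> rw [h]
  · simp
  · simp [succ_ne]

/-- The code lies between `(a + b)²` and `(a + b + 1)²`, excluding the latter, so it determines the
sum `a + b`, and then `a`. -/
theorem pair_inj {a b c d : M.C .nat} (h : (a + b) * (a + b) + a = (c + d) * (c + d) + c) :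
    a = c ∧ b = d := by
  have key : ∀ {a b c d : M.C .nat}, (a + b) * (a + b) + a = (c + d) * (c + d) + c →
      ¬ a + b < c + d := by
    intro a b c d h h'
    rw [nat_lt_iff] at h'
    have h1 := mul_le_mul h' h' (nat_zero_le _) (nat_zero_le _)
    have h2 : (a + b + 1) * (a + b + 1) = (a + b) * (a + b) + a + (a + b + b) + 1 := by ring
    have h3 := (h1.trans (le_add_of_nonneg_right (nat_zero_le c))).trans_eq h.symm
    rw [h2, ← nat_lt_iff] at h3
    exact absurd h3 (not_lt.2 (le_add_of_nonneg_right (nat_zero_le _)))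
  have h' : a + b = c + d := le_antisymm (not_lt.1 (key h.symm)) (not_lt.1 (key h))
  rw [h'] at h
  have : a = c := nat_add_left_cancel h
  subst this
  exact ⟨rfl, nat_add_left_cancel h'⟩

/-- Both components are bounded by the code, so decoding a pair is a bounded search. -/
theorem le_pair_left (a b : M.C .nat) : a ≤ (a + b) * (a + b) + a := ⟨_, add_comm _ _⟩

theorem le_pair_right (a b : M.C .nat) : b ≤ (a + b) * (a + b) + a := by
  rcases eq_zero_or_succ b with rfl | ⟨b, rfl⟩
  · exact nat_zero_le _
  · exact ⟨a * a + b * b + 2 * a * b + 3 * a + b, by ring⟩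

/-! ### Bounded search -/

/-- The value of bounded search. -/
def search (f : M.C .one) (n : M.C .nat) : M.C .nat := M.app (M.app (M.eval M.nil searchT) f) n

theorem search_zero (f : M.C .one) : search f 0 = 0 := by
  simp [search, searchT, Str.eval, Str.Env.cons, Str.eval_lift, zero_eq]

open Classical in
theorem search_succ (f : M.C .one) (n : M.C .nat) : search f (n + 1) =
    if M.app f (search f n) = 0 then search f n else n + 1 := by
  simp [search, searchT, Str.eval, Str.Env.cons, Str.eval_lift, zero_eq]

theorem Rep.search {f : M.C .one} {g : M.C .nat → M.C .nat} (hg : Rep g) :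
    Rep fun x => search f (g x) := (Rep.const _).app hg

theorem Dec.le {f g : M.C .nat → M.C .nat} (hf : Rep f) (hg : Rep g) :
    Dec fun x => f x ≤ g x := by
  simp only [← nat_sub_eq_zero]
  exact .eq (.sub hf hg) (.const _)

theorem search_le (f : M.C .one) (n : M.C .nat) : search f n ≤ n := by
  induction n using ind with
  | hP => exact .le (.search .id) .id
  | h0 => rw [search_zero]
  | h1 x h =>
    rw [search_succ]
    split_ifs
    · exact h.trans ⟨1, rfl⟩
    · exact le_rfl

theorem search_spec {f : M.C .one} {n x : M.C .nat} (hx : x ≤ n) (h : M.app f x = 0) :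
    M.app f (search f n) = 0 := by
  obtain ⟨w, rfl⟩ := hx
  -- Induction on the distance from `x` to `n`: once a zero is found, the search keeps its value.
  induction w using ind with
  | hP => exact .eq (.app (.const _) (.search (.add (.const _) .id))) (.const _)
  | h0 =>
    -- At stage `x` the search has either stopped at a zero or advanced all the way to `x`.
    have : search f x = x ∨ M.app f (search f x) = 0 := by
      clear h
      induction x using ind with
      | hP => exact .or (.eq (.search .id) .id) (.eq (.app (.const _) (.search .id)) (.const _))
      | h0 => exact .inl (search_zero f)
      | h1 x h =>
        rw [search_succ]
        split_ifs with h'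
        · exact .inr h'
        · exact .inl rfl
    rw [add_zero]
    rcases this with h' | h'
    · rwa [h']
    · exact h'
  | h1 w h' => rwa [← add_assoc, search_succ, if_pos h']

theorem exists_le_iff_search {f : M.C .one} {n : M.C .nat} :
    M.app f (search f n) = 0 ↔ ∃ x ≤ n, M.app f x = 0 :=
  ⟨fun h => ⟨_, search_le f n, h⟩, fun ⟨_, h, h'⟩ => search_spec h h'⟩

end Model

/-- `0` if `t x = 0` for some `x ≤ n`. -/
def Tm.bex {Γ : Ctx} (n : Tm Γ .nat) (t : Tm (.nat :: Γ) .nat) : Tm Γ .nat :=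
  t.lam ⬝ (searchT.lift ⬝ t.lam ⬝ n)

theorem Model.eval_bex {M : Model} {Γ : Ctx} (ρ : M.Env Γ) (n : Tm Γ .nat)
    (t : Tm (.nat :: Γ) .nat) :
    M.eval ρ (.bex n t) = 0 ↔ ∃ x ≤ M.eval ρ n, M.eval (ρ.cons x) t = 0 := by
  simp only [← Model.eval_lam]
  rw [← Model.exists_le_iff_search]
  simp only [Tm.bex, Str.eval_app, Str.eval_lift]
  rfl

/-- `0` if `s = t`. -/
def Tm.eqb {Γ : Ctx} (s t : Tm Γ .nat) : Tm Γ .nat :=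
  (subT.lift ⬝ s ⬝ t).add (subT.lift ⬝ t ⬝ s)

theorem Model.eval_eqb {M : Model} {Γ : Ctx} (ρ : M.Env Γ) (s t : Tm Γ .nat) :
    M.eval ρ (.eqb s t) = 0 ↔ M.eval ρ s = M.eval ρ t := by
  simp only [Tm.eqb, Model.eval_add, Str.eval_app, Str.eval_lift]
  refine Model.nat_add_eq_zero.trans ((and_congr Model.nat_sub_eq_zero
    Model.nat_sub_eq_zero).trans le_antisymm_iff.symm)


/-! ### Truth of the defined formulas -/

section
variable {M : Str} {Γ : Ctx} (ρ : M.Env Γ)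

@[simp] theorem Str.sat_eq (s t : Tm Γ .nat) : M.sat ρ (.eq s t) ↔ M.eval ρ s = M.eval ρ t := Iff.rfl

@[simp] theorem Str.sat_bot : M.sat ρ .bot ↔ False := Iff.rfl

@[simp] theorem Str.sat_imp (φ ψ : Fm Γ) : M.sat ρ (.imp φ ψ) ↔ (M.sat ρ φ → M.sat ρ ψ) := Iff.rfl

@[simp] theorem Str.sat_all (τ : Ty) (φ : Fm (τ :: Γ)) :
    M.sat ρ (.all τ φ) ↔ ∀ a, M.sat (ρ.cons a) φ := Iff.rfl

@[simp] theorem Str.sat_not (φ : Fm Γ) : M.sat ρ φ.not ↔ ¬ M.sat ρ φ := Iff.rfl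

@[simp] theorem Str.sat_and (φ ψ : Fm Γ) : M.sat ρ (φ.and ψ) ↔ M.sat ρ φ ∧ M.sat ρ ψ := by
  simp [Fm.and]

@[simp] theorem Str.sat_or (φ ψ : Fm Γ) : M.sat ρ (φ.or ψ) ↔ M.sat ρ φ ∨ M.sat ρ ψ := by
  simp [Fm.or, or_iff_not_imp_left]

@[simp] theorem Str.sat_iff (φ ψ : Fm Γ) : M.sat ρ (φ.iff ψ) ↔ (M.sat ρ φ ↔ M.sat ρ ψ) := by
  simp [Fm.iff, iff_def]

@[simp] theorem Str.sat_ex (τ : Ty) (φ : Fm (τ :: Γ)) :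
    M.sat ρ (.ex τ φ) ↔ ∃ a, M.sat (ρ.cons a) φ := by
  simp [Fm.ex]

@[simp] theorem Str.sat_allx (τ : Ty) (f : Tm (τ :: Γ) τ → Fm (τ :: Γ)) :
    M.sat ρ (.allx τ f) ↔ ∀ a, M.sat (ρ.cons a) (f v0) := Iff.rfl

@[simp] theorem Str.sat_exx (τ : Ty) (f : Tm (τ :: Γ) τ → Fm (τ :: Γ)) :
    M.sat ρ (.exx τ f) ↔ ∃ a, M.sat (ρ.cons a) (f v0) := Str.sat_ex ρ τ _

@[simp] theorem Str.eval_v0 {τ : Ty} (a : M.C τ) : M.eval (ρ.cons a) v0 = a := rfl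

@[simp] theorem Str.eval_v1 {σ τ : Ty} (a : M.C τ) (b : M.C σ) :
    M.eval ((ρ.cons a).cons b) v1 = a := rfl

@[simp] theorem Str.eval_v2 {π σ τ : Ty} (a : M.C τ) (b : M.C σ) (c : M.C π) :
    M.eval (((ρ.cons a).cons b).cons c) v2 = a := rfl

end

attribute [simp] Str.eval_wk Str.eval_lift

namespace Model

variable {M : Model} {Γ : Ctx} (ρ : M.Env Γ)

@[simp] theorem eval_zero : M.eval ρ .zero = 0 := rfl

@[simp] theorem eval_succ : M.eval ρ .succ = M.succ := rfl

@[simp] theorem eval_rc : M.eval ρ .rc = M.rc := rfl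

@[simp] theorem sat_lt (s t : Tm Γ .nat) : M.sat ρ (.lt s t) ↔ M.eval ρ s < M.eval ρ t := by
  simp [Fm.lt, lt_def]

/-- The value of the code of a pair. -/
def pair (a b : M.C .nat) : M.C .nat := (a + b) * (a + b) + a

@[simp] theorem eval_pair (s t : Tm Γ .nat) : M.eval ρ (s.pair t) = pair (M.eval ρ s) (M.eval ρ t) := rfl

/-- `i ≤_X j`. -/
def Le (X : M.C .one) (i j : M.C .nat) : Prop := M.app X (pair i j) = 1

@[simp] theorem sat_mem (x : Tm Γ .nat) (X : Tm Γ .one) :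
    M.sat ρ (.mem x X) ↔ M.app (M.eval ρ X) (M.eval ρ x) = 1 := by
  simp [Fm.mem]

@[simp] theorem sat_le (X : Tm Γ .one) (i j : Tm Γ .nat) :
    M.sat ρ (.le X i j) ↔ Le (M.eval ρ X) (M.eval ρ i) (M.eval ρ j) := sat_mem ρ _ _

@[simp] theorem sat_inField (X : Tm Γ .one) (i : Tm Γ .nat) :
    M.sat ρ (.inField X i) ↔ Le (M.eval ρ X) (M.eval ρ i) (M.eval ρ i) := sat_le ρ _ _ _

@[simp] theorem sat_incomp (X : Tm Γ .one) (i j : Tm Γ .nat) : M.sat ρ (.incomp X i j) ↔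
    ¬ Le (M.eval ρ X) (M.eval ρ i) (M.eval ρ j) ∧ ¬ Le (M.eval ρ X) (M.eval ρ j) (M.eval ρ i) := by
  simp [Fm.incomp]

/-- `X` is an infinite partial order. -/
structure IsInfPO (X : M.C .one) : Prop where
  isSet : ∀ n, M.app X n = 0 ∨ M.app X n = 1
  field : ∀ i j, Le X i j → Le X i i ∧ Le X j j
  antisymm : ∀ i j, Le X i j → Le X j i → i = j
  trans : ∀ i j k, Le X i j → Le X j k → Le X i k
  inf : ∀ k, ∃ n, k < n ∧ Le X n n

@[simp] theorem sat_isInfPO (X : Tm Γ .one) : M.sat ρ (.isInfPO X) ↔ IsInfPO (M.eval ρ X) := by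
  simp only [Fm.isInfPO, Fm.isPO, Fm.isSet, Str.sat_and, Str.sat_or, Str.sat_allx, Str.sat_exx,
    Str.sat_imp, Str.sat_eq, sat_le, sat_inField, sat_lt, Str.eval_wk, Str.eval_app, Str.eval_v0,
    eval_zero, eval_succ, succ_app, zero_add, and_assoc]
  exact ⟨fun ⟨a, b, c, d, e⟩ => ⟨a, b, c, d, e⟩, fun ⟨a, b, c, d, e⟩ => ⟨a, b, c, d, e⟩⟩

/-- `S` is an infinite subset of `X` that is a chain or an antichain. -/
structure IsSolution (X S : M.C .one) : Prop where
  isSet : ∀ n, M.app S n = 0 ∨ M.app S n = 1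
  field : ∀ n, M.app S n = 1 → Le X n n
  inf : ∀ k, ∃ n, k < n ∧ M.app S n = 1
  hom : (∀ x y, M.app S x = 1 → M.app S y = 1 → Le X x y ∨ Le X y x) ∨
    ∀ x y, M.app S x = 1 → M.app S y = 1 → x ≠ y → ¬ Le X x y ∧ ¬ Le X y x

@[simp] theorem sat_isSolution (X S : Tm Γ .one) :
    M.sat ρ (.isSolution X S) ↔ IsSolution (M.eval ρ X) (M.eval ρ S) := by
  simp only [Fm.isSolution, Fm.isInfSubset, Fm.isSet, Fm.isChain, Fm.isAntichain, Str.sat_and,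
    Str.sat_or, Str.sat_allx, Str.sat_exx, Str.sat_imp, Str.sat_eq, Str.sat_not, sat_le, sat_mem,
    sat_inField, sat_incomp, sat_lt, Str.eval_wk, Str.eval_app, Str.eval_v0,
    eval_zero, eval_succ, succ_app, zero_add, and_assoc]
  exact ⟨fun ⟨a, b, c, d⟩ => ⟨a, b, c, d⟩, fun ⟨a, b, c, d⟩ => ⟨a, b, c, d⟩⟩

/-- `X` is stable because almost all elements are above or incomparable with a given one. -/
theorem sat_isStable_of (X : Tm Γ .one)
    (h : ∀ i, Le (M.eval ρ X) i i → ∃ s,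
      (∀ j, s < j → Le (M.eval ρ X) j j → Le (M.eval ρ X) i j ∧ i ≠ j) ∨
      ∀ j, s < j → Le (M.eval ρ X) j j → ¬ Le (M.eval ρ X) i j ∧ ¬ Le (M.eval ρ X) j i) :
    M.sat ρ (.isStable X) := by
  rw [Fm.isStable, Str.sat_or]
  refine .inl ?_
  simpa only [Fm.slt, Str.sat_and, Str.sat_or, Str.sat_allx, Str.sat_exx, Str.sat_imp, Str.sat_eq,
    Str.sat_not, sat_le, sat_inField, sat_incomp, sat_lt, Str.eval_wk, Str.eval_v0] using h

theorem sat_MU (μ : M.C .two) : M.sat (M.nil.cons μ) MU ↔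
    ∀ f, (∃ n, M.app f n = 0) → M.app f (M.app μ f) = 0 := by
  simp [MU]

theorem sat_UCAC (Ψ : M.C (.one ⇾ .one)) : M.sat (M.nil.cons Ψ) UCAC ↔
    ∀ X, IsInfPO X → IsSolution X (M.app Ψ X) := by
  simp [UCAC]

theorem sat_USCAC (Ψ : M.C (.one ⇾ .one)) : M.sat (M.nil.cons Ψ) USCAC ↔
    ∀ X, IsInfPO X → M.sat (M.nil.cons Ψ |>.cons X) (.isStable v0) → IsSolution X (M.app Ψ X) := by
  simp [USCAC]

end Model

/-! ### From chains and antichains to unbounded search -/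

/-- `0` if `i = j`, or `i ≤ j` and `f` has a zero `≤ i`. -/
def relT : Tm [] (.one ⇾ .nat ⇾ .nat ⇾ .nat) :=
  .lam (.lam (.lam (.ite (.eqb v1 v0) .zero
    ((subT.lift ⬝ v1 ⬝ v0).add (v2 ⬝ (searchT.lift ⬝ v2 ⬝ v1))))))

/-- The partial order in which the numbers below the least zero of `f` are isolated, and the other
ones are ordered as usual. -/
def orderT : Tm [] (.one ⇾ .one) :=
  .lam (.lam (.ite (.bex v0 (.bex v1
    ((Tm.eqb (v1.pair v0) v2).add (relT.lift ⬝ .bv (.there (.there (.there .here))) ⬝ v1 ⬝ v0))))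
      (.succ ⬝ .zero) .zero))

namespace Model

variable {M : Model}

theorem relT_app (f : M.C .one) (i j : M.C .nat) :
    M.app (M.app (M.app (M.eval M.nil relT) f) i) j = 0 ↔
      i = j ∨ i ≤ j ∧ ∃ k ≤ i, M.app f k = 0 := by
  rw [← exists_le_iff_search, ← nat_sub_eq_zero]
  simp only [relT, eval_lam, eval_ite, eval_eqb, Str.eval_v0, Str.eval_v1, Str.eval_v2, eval_zero,
    eval_add, Str.eval_app, Str.eval_lift]
  split_ifs with h
  · simp [h]
  · simp only [h, false_or]
    exact nat_add_eq_zero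

theorem orderT_app (f : M.C .one) (z : M.C .nat) :
    (M.app (M.app (M.eval M.nil orderT) f) z = 0 ∨ M.app (M.app (M.eval M.nil orderT) f) z = 1) ∧
    (M.app (M.app (M.eval M.nil orderT) f) z = 1 ↔
      ∃ i j, pair i j = z ∧ (i = j ∨ i ≤ j ∧ ∃ k ≤ i, M.app f k = 0)) := by
  have h3 : ∀ (j i z : M.C .nat), M.eval (M.nil.cons f |>.cons z |>.cons i |>.cons j)
    (.bv (.there (.there (.there .here)))) = f := fun _ _ _ => rfl
  simp only [orderT, eval_lam, eval_ite, eval_zero, Str.eval_app, eval_succ, succ_app, zero_add]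
  -- The term only searches components `≤ z`; since a code bounds its components, the bounds can be
  -- dropped.
  have key : (∃ i ≤ z, ∃ j ≤ z, pair i j = z ∧ (i = j ∨ i ≤ j ∧ ∃ k ≤ i, M.app f k = 0)) ↔
      ∃ i j, pair i j = z ∧ (i = j ∨ i ≤ j ∧ ∃ k ≤ i, M.app f k = 0) := by
    constructor
    · rintro ⟨i, -, j, -, h⟩
      exact ⟨i, j, h⟩
    · rintro ⟨i, j, rfl, h⟩
      exact ⟨i, le_pair_left i j, j, le_pair_right i j, rfl, h⟩
  split_ifs with h <;> simp only [eval_bex, eval_eqb, Str.eval_v0, Str.eval_v1, Str.eval_v2,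
    eval_add, Str.eval_app, Str.eval_lift, h3, nat_add_eq_zero, relT_app, eval_pair, key] at h <;>
    simp [h]

theorem le_orderT (f : M.C .one) (i j : M.C .nat) :
    Le (M.app (M.eval M.nil orderT) f) i j ↔ i = j ∨ i ≤ j ∧ ∃ k ≤ i, M.app f k = 0 := by
  rw [Le, (orderT_app f _).2]
  constructor
  · rintro ⟨i', j', h, h'⟩
    obtain ⟨rfl, rfl⟩ := pair_inj h
    exact h'
  · exact fun h => ⟨i, j, rfl, h⟩

theorem isInfPO_orderT (f : M.C .one) : IsInfPO (M.app (M.eval M.nil orderT) f) where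
  isSet n := (orderT_app f n).1
  field i j _ := by simp [le_orderT]
  antisymm i j h h' := by
    rw [le_orderT] at h h'
    rcases h with h | h
    · exact h
    · rcases h' with h' | h'
      · exact h'.symm
      · exact le_antisymm h.1 h'.1
  trans i j k h h' := by
    rw [le_orderT] at *
    rcases h with rfl | h
    · exact h'
    · rcases h' with rfl | h'
      · exact .inr h
      · exact .inr ⟨h.1.trans h'.1, h.2⟩
  inf k := ⟨k + 1, nat_lt_succ.2 le_rfl, by simp [le_orderT]⟩

/-- The bound `s = i` works. Whether `f` has a zero `≤ i` decides if `i` lies below all larger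
numbers or is incomparable with them. -/
theorem isStable_orderT (f : M.C .one) {Γ : Ctx} (ρ : M.Env Γ) :
    M.sat (ρ.cons (M.app (M.eval M.nil orderT) f)) (.isStable v0) := by
  refine sat_isStable_of _ _ fun i _ => ⟨i, ?_⟩
  simp only [Str.eval_v0, le_orderT]
  by_cases h : ∃ k ≤ i, M.app f k = 0
  · exact .inl fun j hj _ => ⟨.inr ⟨hj.le, h⟩, hj.ne⟩
  · refine .inr fun j hj _ => ⟨?_, ?_⟩
    · rintro (rfl | h')
      exacts [lt_irrefl _ hj, h h'.2]
    · rintro (rfl | h')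
      exacts [lt_irrefl _ hj, not_lt.2 h'.1 hj]

/-- The elements of an infinite chain or antichain bound the least zero. -/
theorem exists_zero_le {f S : M.C .one} (hS : IsSolution (M.app (M.eval M.nil orderT) f) S)
    {n : M.C .nat} (hn : M.app S n = 1) (hf : ∃ k, M.app f k = 0) : ∃ k ≤ n, M.app f k = 0 := by
  obtain ⟨k, hk⟩ := hf
  rcases hS.hom with h | h
  -- In a chain, `n` is comparable with some larger `m`; being distinct, they can be related only
  -- through a zero `≤ n`.
  · obtain ⟨m, hm, hm'⟩ := hS.inf n
    have := h n m hn hm'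
    rw [le_orderT, le_orderT] at this
    rcases this with (rfl | h) | (rfl | h)
    · exact (lt_irrefl _ hm).elim
    · exact h.2
    · exact (lt_irrefl _ hm).elim
    · exact (not_lt.2 h.1 hm).elim
  -- An antichain is impossible: two of its elements beyond the zero `k` would be comparable.
  · obtain ⟨a, ha, ha'⟩ := hS.inf k
    obtain ⟨b, hb, hb'⟩ := hS.inf a
    refine ((h a b ha' hb' hb.ne).1 ?_).elim
    exact (le_orderT f a b).2 (.inr ⟨hb.le, k, ha.le, hk⟩)

end Model

/-- A search bound for the least zero of `f`. -/
def searchFm : Fm [Ty.nat, Ty.one, Ty.one ⇾ Ty.one] := .mem v0 (v2 ⬝ (orderT.lift ⬝ v1))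

/-- The operator `μ` from `Ψ` and a search functional. -/
def muT : Tm [] ((.one ⇾ .one) ⇾ .two ⇾ .two) :=
  -- The argument `Ψ` is discarded: all that is needed from it is the bound `Θ f`.
  .kc _ _ ⬝ Tm.lam (.lam (searchT.lift ⬝ v0 ⬝ (v1 ⬝ v0)))

/-! ### Closedness of the terms for the search -/

theorem closed_predT : predT.Closed := fun τ n => by simp [predT, Tm.Fresh]

theorem closed_subT : subT.Closed := fun τ n => by
  simp [subT, Tm.Fresh, closed_predT τ n]

theorem fresh_ite {Γ : Ctx} {c s t : Tm Γ .nat} {τ : Ty} {n : ℕ} :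
    (Tm.ite c s t).Fresh τ n ↔ c.Fresh τ n ∧ s.Fresh τ n ∧ t.Fresh τ n := by
  simp [Tm.ite, Tm.Fresh, and_assoc]

theorem closed_searchT : searchT.Closed := fun τ n => by
  simp [searchT, Tm.Fresh, fresh_ite]

theorem fresh_add {Γ : Ctx} {s t : Tm Γ .nat} {τ : Ty} {n : ℕ} :
    (s.add t).Fresh τ n ↔ s.Fresh τ n ∧ t.Fresh τ n := by
  simp [Tm.add, stepSucc, Tm.Fresh, and_comm]

theorem fresh_mul {Γ : Ctx} {s t : Tm Γ .nat} {τ : Ty} {n : ℕ} :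
    (s.mul t).Fresh τ n ↔ s.Fresh τ n ∧ t.Fresh τ n := by
  simp [Tm.mul, stepAdd, stepSucc, Tm.Fresh, and_comm]

theorem fresh_pair {Γ : Ctx} {s t : Tm Γ .nat} {τ : Ty} {n : ℕ} :
    (s.pair t).Fresh τ n ↔ s.Fresh τ n ∧ t.Fresh τ n := by
  simp only [Tm.pair, fresh_add, fresh_mul]
  tauto

theorem fresh_eqb {Γ : Ctx} {s t : Tm Γ .nat} {τ : Ty} {n : ℕ} :
    (Tm.eqb s t).Fresh τ n ↔ s.Fresh τ n ∧ t.Fresh τ n := by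
  simp only [Tm.eqb, fresh_add, Tm.fresh_app, Tm.fresh_lift, closed_subT τ n]
  tauto

theorem fresh_bex {Γ : Ctx} {s : Tm Γ .nat} {t : Tm (.nat :: Γ) .nat} {τ : Ty} {n : ℕ} :
    (Tm.bex s t).Fresh τ n ↔ s.Fresh τ n ∧ t.Fresh τ n := by
  simp only [Tm.bex, Tm.fresh_app, Tm.fresh_lift, closed_searchT τ n, Tm.fresh_lam]
  tauto

theorem closed_relT : relT.Closed := fun τ n => by
  simp [relT, Tm.Fresh, fresh_ite, fresh_eqb, fresh_add, closed_subT τ n, closed_searchT τ n]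

theorem closed_orderT : orderT.Closed := fun τ n => by
  simp [orderT, Tm.Fresh, fresh_ite, fresh_eqb, fresh_add, fresh_bex, fresh_pair, closed_relT τ n]

theorem closed_muT : muT.Closed := fun τ n => by
  simp [muT, Tm.Fresh, closed_searchT τ n]

theorem closed_searchFm : searchFm.Closed := fun τ n => by
  simp [searchFm, Fm.mem, Fm.Fresh, Tm.Fresh, closed_orderT τ n]

namespace Model

variable {M : Model}

theorem muT_app {f : M.C .one} {Ψ : M.C (.one ⇾ .one)} {Θ : M.C .two}
    (h : IsSolution (M.app (M.eval M.nil orderT) f) (M.app Ψ (M.app (M.eval M.nil orderT) f)))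
    (hΘ : M.app (M.app Ψ (M.app (M.eval M.nil orderT) f)) (M.app Θ f) = 1)
    (hf : ∃ n, M.app f n = 0) :
    M.app f (M.app (M.app (M.app (M.eval M.nil muT) Ψ) Θ) f) = 0 := by
  have : M.app (M.app (M.app (M.eval M.nil muT) Ψ) Θ) f = search f (M.app Θ f) := by
    simp [muT, Str.eval, search, Str.Env.cons]
  rw [this, exists_le_iff_search]
  exact exists_zero_le h hΘ hf

/-- A uniform solution on the orders above yields `μ` by unbounded search. -/
theorem exists_mu {Ψ : M.C (.one ⇾ .one)} (h : ∀ f, IsSolution (M.app (M.eval M.nil orderT) f)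
    (M.app Ψ (M.app (M.eval M.nil orderT) f))) : ∃ μ, M.sat (M.nil.cons μ) MU := by
  obtain ⟨t, rfl⟩ := M.named Ψ
  -- The choice axiom is a schema over formulas, so `Ψ` enters through its name `t`.
  have := M.ax (.qf_ac (.mem v0 (t.lift ⬝ (orderT.lift ⬝ v1))) trivial)
  simp only [Str.sat_imp, Str.sat_all, Str.sat_ex, Str.sat_subst, Str.eval_cons, sat_mem,
    Str.eval_app, Str.eval_lift, Str.eval_v0, Str.eval_v1] at this
  obtain ⟨Θ, hΘ⟩ := this fun f => ((h f).inf 0).imp fun n hn => hn.2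
  exact ⟨_, (sat_MU _).2 fun f hf => muT_app (h f) (hΘ f) hf⟩

end Model

/-- `μ` from any principle that provides solutions for the orders above. -/
theorem explicitSearch_MU {A : Fm [Ty.one ⇾ Ty.one]}
    (hA : ∀ (M : Model) (Ψ : M.C (.one ⇾ .one)), M.sat (M.nil.cons Ψ) A → ∀ f,
      Model.IsSolution (M.app (M.eval M.nil orderT) f)
        (M.app Ψ (M.app (M.eval M.nil orderT) f))) : ExplicitSearch A MU := by
  refine ⟨searchFm, muT, trivial, closed_searchFm, closed_muT,
    provable_of_sat fun M => ?_, provable_of_sat fun M => ?_⟩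
  · simp only [Str.sat_imp, Str.sat_all, Str.sat_ex, searchFm, Model.sat_mem,
      Str.eval_app, Str.eval_lift, Str.eval_v0, Str.eval_v1, Str.eval_v2]
    exact fun Ψ hΨ f => ((hA M Ψ hΨ f).inf 0).imp fun n hn => hn.2
  · simp only [Str.sat_imp, Str.sat_all, Str.sat_inst, Str.sat_subst, Str.eval_cons, searchFm,
      Model.sat_mem, Model.sat_MU,
      Str.eval_app, Str.eval_lift, Str.eval_v0, Str.eval_v1, Str.eval_v2]
    exact fun Ψ Θ hΨ hΘ f hf => Model.muT_app (hA M Ψ hΨ f) (hΘ f) hf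

theorem Model.isSolution_of_UCAC (M : Model) (Ψ : M.C (.one ⇾ .one))
    (h : M.sat (M.nil.cons Ψ) UCAC) (f : M.C .one) :
    IsSolution (M.app (M.eval M.nil orderT) f) (M.app Ψ (M.app (M.eval M.nil orderT) f)) :=
  (Model.sat_UCAC Ψ).1 h _ (isInfPO_orderT f)

theorem Model.isSolution_of_USCAC (M : Model) (Ψ : M.C (.one ⇾ .one))
    (h : M.sat (M.nil.cons Ψ) USCAC) (f : M.C .one) :
    IsSolution (M.app (M.eval M.nil orderT) f) (M.app Ψ (M.app (M.eval M.nil orderT) f)) :=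
  (Model.sat_USCAC Ψ).1 h _ (isInfPO_orderT f) (isStable_orderT f _)


/-! ### Arithmetical comprehension from `μ` -/

/-- Formulas that only have quantifiers of type `0`. -/
def Fm.Arith : {Γ : Ctx} → Fm Γ → Prop
  | _, .eq _ _ => True
  | _, .bot => True
  | _, .imp φ ψ => φ.Arith ∧ ψ.Arith
  | _, .all .nat φ => φ.Arith
  | _, .all (.arr _ _) _ => False

/-- The characteristic function of an arithmetical formula: `0` if true, `1` if false. -/
def Fm.chi : {Γ : Ctx} → Fm Γ → Tm Γ .two → Tm Γ .nat
  | _, .eq s t, _ => .ite (.eqb s t) .zero (.succ ⬝ .zero)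
  | _, .bot, _ => .succ ⬝ .zero
  | _, .imp φ ψ, m => .ite (φ.chi m) (ψ.chi m) .zero
  -- The abstracted function vanishes exactly at the counterexamples to `φ`. Its value at the point
  -- proposed by `μ` is `0` if and only if there is one.
  | _, .all .nat φ, m =>
    .ite (Tm.lam (.ite (φ.chi m.wk) (.succ ⬝ .zero) .zero) ⬝
      (m ⬝ Tm.lam (.ite (φ.chi m.wk) (.succ ⬝ .zero) .zero))) (.succ ⬝ .zero) .zero
  -- A default value, irrelevant for arithmetical formulas.
  | _, .all (.arr _ _) _, _ => .zero

theorem fresh_chi {Γ : Ctx} {φ : Fm Γ} {m : Tm Γ .two} {τ : Ty} {n : ℕ} (hφ : φ.Fresh τ n)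
    (hm : m.Fresh τ n) : (φ.chi m).Fresh τ n := by
  induction φ with
  | eq s t =>
    simp only [Fm.Fresh] at hφ
    simp [Fm.chi, fresh_ite, fresh_eqb, hφ, Tm.Fresh]
  | bot => simp [Fm.chi, Tm.Fresh]
  | imp φ ψ h₁ h₂ =>
    simp only [Fm.Fresh] at hφ
    simp [Fm.chi, fresh_ite, h₁ hφ.1 hm, h₂ hφ.2 hm, Tm.Fresh]
  | all σ φ h =>
    cases σ with
    | nat =>
      have := h (m := m.wk) hφ (by simpa using hm)
      simp [Fm.chi, fresh_ite, this, Tm.Fresh, hm]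
    | arr => simp [Fm.chi, Tm.Fresh]

namespace Model

variable {M : Model}

/-- `μ` finds a zero of every function that has one. -/
def IsMu (μ : M.C .two) : Prop := ∀ f, (∃ n, M.app f n = 0) → M.app f (M.app μ f) = 0

open Classical in
theorem eval_chi {Γ : Ctx} (ρ : M.Env Γ) {φ : Fm Γ} (hφ : φ.Arith) {m : Tm Γ .two}
    (hm : IsMu (M.eval ρ m)) : M.eval ρ (φ.chi m) = if M.sat ρ φ then 0 else 1 := by
  induction φ with
  | eq s t => simp [Fm.chi, eval_eqb]
  | bot => simp [Fm.chi]
  | imp φ ψ h₁ h₂ =>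
    rw [Fm.chi, eval_ite, h₁ ρ hφ.1 hm, h₂ ρ hφ.2 hm, Str.sat_imp]
    by_cases h : M.sat ρ φ <;> simp [h]
  | all σ φ h =>
    cases σ with
    | nat =>
      have key : ∀ n, M.eval (ρ.cons n) (.ite (φ.chi m.wk) (.succ ⬝ .zero) .zero) = 0 ↔
          ¬ M.sat (ρ.cons n) φ := by
        intro n
        rw [eval_ite, h (ρ.cons n) hφ (by rwa [Str.eval_wk])]
        by_cases h : M.sat (ρ.cons n) φ <;> simp [h]
      have hmu := hm (M.eval ρ (Tm.lam (.ite (φ.chi m.wk) (.succ ⬝ .zero) .zero)))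
      rw [Fm.chi, eval_ite, Str.sat_all, Str.eval_app, Str.eval_app]
      simp only [eval_lam, key] at hmu ⊢
      by_cases h : ∀ a, M.sat (ρ.cons a) φ
      · simp [h]
      · rw [if_neg h, if_pos (hmu (not_forall.1 h))]
        simp
    | arr => exact hφ.elim

/-- With `μ`, an arithmetical formula is equivalent to the equation of its characteristic term with
`0`, so quantifier-free induction yields arithmetical induction. -/
theorem Dec.arith {Γ : Ctx} (ρ : M.Env Γ) {φ : Fm (.nat :: Γ)} (hφ : φ.Arith) {m : Tm Γ .two}
    (hm : IsMu (M.eval ρ m)) : Dec fun x => M.sat (ρ.cons x) φ := by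
  have : ∀ x, M.sat (ρ.cons x) φ ↔ M.eval (ρ.cons x) (φ.chi m.wk) = 0 := by
    intro x
    rw [eval_chi (ρ.cons x) hφ (by rwa [Str.eval_wk])]
    by_cases h : M.sat (ρ.cons x) φ <;> simp [h]
  simp only [this]
  exact .eq (.eval ρ _) (.const _)

end Model

/-! ### Infinite chains and antichains from `μ` -/

abbrev v3 {Γ : Ctx} {π ρ σ τ : Ty} : Tm (π :: ρ :: σ :: τ :: Γ) τ :=
  .bv (.there (.there (.there .here)))
abbrev v4 {Γ : Ctx} {θ π ρ σ τ : Ty} : Tm (θ :: π :: ρ :: σ :: τ :: Γ) τ :=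
  .bv (.there (.there (.there (.there .here))))
abbrev v5 {Γ : Ctx} {η θ π ρ σ τ : Ty} : Tm (η :: θ :: π :: ρ :: σ :: τ :: Γ) τ :=
  .bv (.there (.there (.there (.there (.there .here)))))

section
variable {M : Str} {Γ : Ctx} (ρ : M.Env Γ)

@[simp] theorem Str.eval_v3 {π ρ' σ τ : Ty} (a : M.C τ) (b : M.C σ) (c : M.C π) (d : M.C ρ') :
    M.eval ((((ρ.cons a).cons b).cons c).cons d) v3 = a := rfl

@[simp] theorem Str.eval_v4 {π ρ' σ τ θ : Ty} (a : M.C τ) (b : M.C σ) (c : M.C π) (d : M.C ρ')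
    (e : M.C θ) : M.eval (((((ρ.cons a).cons b).cons c).cons d).cons e) v4 = a := rfl

@[simp] theorem Str.eval_v5 {π ρ' σ τ θ η : Ty} (a : M.C τ) (b : M.C σ) (c : M.C π) (d : M.C ρ')
    (e : M.C θ) (f : M.C η) :
    M.eval ((((((ρ.cons a).cons b).cons c).cons d).cons e).cons f) v5 = a := rfl

end

/-- The recursion step for `patT`. -/
def patStepT : Tm [] (.two ⇾ .one ⇾ .nat ⇾ .nat ⇾ .nat ⇾ .nat) :=
  .lam (.lam (.lam (.lam (.lam (v1.pair ((Fm.or (.le v3 v0 v2) (.le v3 v2 v0)).chi v4))))))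

/-- The code of the comparability pattern of `j` with the numbers below `n`, given `μ`, `X`, `n`
and `j`. -/
def patT : Tm [] (.two ⇾ .one ⇾ .nat ⇾ .nat ⇾ .nat) :=
  .lam (.lam (.lam (.lam (.rc ⬝ v1 ⬝ .zero ⬝ (patStepT.lift ⬝ v3 ⬝ v2 ⬝ v0)))))

/-- Infinitely many `j` in the field have the pattern `u` extended by `0` for the number `v`. The
variables are `v`, `u`, `X` and `μ`. -/
def branchFm : Fm [.nat, .nat, .one, .two] :=
  .all .nat (.ex .nat (.and (.lt v1 v0) (.and (.inField v4 v0)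
    (.eq (patT.lift ⬝ v5 ⬝ v4 ⬝ (.succ ⬝ v2) ⬝ v0) (v3.pair .zero)))))

/-- The recursion step for `branchT`. -/
def branchStepT : Tm [] (.two ⇾ .one ⇾ .nat ⇾ .nat ⇾ .nat) :=
  .lam (.lam (.lam (.lam
    (.ite (branchFm.chi v3) (v1.pair .zero) (v1.pair (.succ ⬝ .zero))))))

/-- The codes of patterns along an infinite branch. -/
def branchT : Tm [] (.two ⇾ .one ⇾ .nat ⇾ .nat) :=
  .lam (.lam (.lam (.rc ⬝ v0 ⬝ .zero ⬝ (branchStepT.lift ⬝ v2 ⬝ v1))))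

/-- `j > m` is in the field and has the pattern given by the branch, where the variables are `j`,
`m`, `X` and `μ`. -/
def nextFm : Fm [.nat, .nat, .one, .two] :=
  .and (.lt v1 v0) (.and (.inField v2 v0)
    (.eq (patT.lift ⬝ v3 ⬝ v2 ⬝ (.succ ⬝ v1) ⬝ v0) (branchT.lift ⬝ v3 ⬝ v2 ⬝ (.succ ⬝ v1))))

/-- A number beyond `m` with the pattern given by the branch. -/
def nextT : Tm [] (.two ⇾ .one ⇾ .nat ⇾ .nat) :=
  .lam (.lam (.lam (v2 ⬝ .lam (nextFm.chi v3))))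

/-- The recursion step for `enumT`. -/
def enumStepT : Tm [] (.two ⇾ .one ⇾ .nat ⇾ .nat ⇾ .nat) :=
  .lam (.lam (.lam (.lam (nextT.lift ⬝ v3 ⬝ v2 ⬝ v1))))

/-- The increasing enumeration of a prehomogeneous set. -/
def enumT : Tm [] (.two ⇾ .one ⇾ .nat ⇾ .nat) :=
  -- The enumeration starts at the number chosen beyond `0`, as `0` itself need not be in the field.
  .lam (.lam (.lam (.rc ⬝ v0 ⬝ (nextT.lift ⬝ v2 ⬝ v1 ⬝ .zero) ⬝ (enumStepT.lift ⬝ v2 ⬝ v1))))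

/-- `x` is in the prehomogeneous set. -/
def rangeFm {Γ : Ctx} (m : Tm Γ .two) (X : Tm Γ .one) (x : Tm Γ .nat) : Fm Γ :=
  .ex .nat (.eq (enumT.lift ⬝ m.wk ⬝ X.wk ⬝ v0) x.wk)

/-- `x` is comparable with the later elements of the prehomogeneous set. -/
def compFm {Γ : Ctx} (m : Tm Γ .two) (X : Tm Γ .one) (x : Tm Γ .nat) : Fm Γ :=
  .eq (branchT.lift ⬝ m ⬝ X ⬝ (.succ ⬝ x)) ((branchT.lift ⬝ m ⬝ X ⬝ x).pair .zero)

/-- `x` is in the infinite homogeneous set. The variables are `x`, `X` and `μ`. -/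
def homFm : Fm [.nat, .one, .two] :=
  -- The biconditional selects the colour: if elements of comparable type are unbounded, exactly
  -- these are kept, and otherwise exactly those of the other type.
  .and (rangeFm v2 v1 v0) (.iff (.all .nat (.ex .nat (.and (.lt v1 v0)
    (.and (rangeFm v4 v3 v0) (compFm v4 v3 v0))))) (compFm v2 v1 v0))

/-- The infinite homogeneous set. -/
def homT : Tm [] (.two ⇾ .one ⇾ .one) :=
  .lam (.lam (.lam (.ite (homFm.chi v2) (.succ ⬝ .zero) .zero)))

/-! ### The Erdős–Rado argument: infinite branch, prehomogeneous sequence, homogeneous set -/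

namespace Model

variable {M : Model}

/-- `i` and `j` are comparable. -/
def Comp (X : M.C .one) (i j : M.C .nat) : Prop := Le X i j ∨ Le X j i

theorem Comp.symm {X : M.C .one} {i j : M.C .nat} (h : Comp X i j) : Comp X j i := Or.symm h

def pat (μ : M.C .two) (X : M.C .one) (n j : M.C .nat) : M.C .nat :=
  M.app (M.app (M.app (M.app (M.eval M.nil patT) μ) X) n) j

def branch (μ : M.C .two) (X : M.C .one) (n : M.C .nat) : M.C .nat :=
  M.app (M.app (M.app (M.eval M.nil branchT) μ) X) n

def next (μ : M.C .two) (X : M.C .one) (n : M.C .nat) : M.C .nat :=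
  M.app (M.app (M.app (M.eval M.nil nextT) μ) X) n

def enum (μ : M.C .two) (X : M.C .one) (n : M.C .nat) : M.C .nat :=
  M.app (M.app (M.app (M.eval M.nil enumT) μ) X) n

/-- The later elements are comparable with `n`. -/
def IsComp (μ : M.C .two) (X : M.C .one) (n : M.C .nat) : Prop :=
  branch μ X (n + 1) = pair (branch μ X n) 0

variable {μ : M.C .two} {X : M.C .one}

open Classical in
theorem pat_succ (hμ : IsMu μ) (n j : M.C .nat) : pat μ X (n + 1) j =
    pair (pat μ X n j) (if Comp X n j then 0 else 1) := by
  simp only [pat, patT, patStepT, eval_lam, Str.eval_app, Str.eval_lift, Str.eval_v0, Str.eval_v1,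
    Str.eval_v2, Str.eval_v3, eval_zero, eval_rc, rc_succ, eval_pair]
  rw [eval_chi _ (by simp [Fm.Arith, Fm.or, Fm.not, Fm.le, Fm.mem]) (by exact hμ)]
  have h : M.sat (M.nil.cons μ |>.cons X |>.cons j |>.cons (pat μ X n j) |>.cons n)
      (.or (.le v3 v0 v2) (.le v3 v2 v0)) ↔ Comp X n j := by simp [Comp]
  simp only [← h]
  simp [pat, patT, patStepT]

theorem sat_branchFm (n u : M.C .nat) :
    M.sat (M.nil.cons μ |>.cons X |>.cons u |>.cons n) branchFm ↔
      ∀ m, ∃ j, m < j ∧ Le X j j ∧ pat μ X (n + 1) j = pair u 0 := by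
  simp [branchFm, pat]

theorem arith_lt {Γ : Ctx} (s t : Tm Γ .nat) : (Fm.lt s t).Arith := by
  simp [Fm.lt, Fm.exx, Fm.ex, Fm.not, Fm.Arith]

theorem arith_and {Γ : Ctx} {φ ψ : Fm Γ} : (φ.and ψ).Arith ↔ φ.Arith ∧ ψ.Arith := by
  simp [Fm.and, Fm.not, Fm.Arith]

theorem arith_ex {Γ : Ctx} {φ : Fm (.nat :: Γ)} : (Fm.ex .nat φ).Arith ↔ φ.Arith := by
  simp [Fm.ex, Fm.not, Fm.Arith]

theorem arith_inField {Γ : Ctx} (X : Tm Γ .one) (i : Tm Γ .nat) : (Fm.inField X i).Arith := trivial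

theorem arith_branchFm : branchFm.Arith := by
  simp [branchFm, Fm.Arith, arith_ex, arith_and, arith_lt, arith_inField]

open Classical in
theorem branch_succ (hμ : IsMu μ) (n : M.C .nat) : branch μ X (n + 1) =
    if ∀ m, ∃ j, m < j ∧ Le X j j ∧ pat μ X (n + 1) j = pair (branch μ X n) 0
    then pair (branch μ X n) 0 else pair (branch μ X n) 1 := by
  simp only [branch, branchT, branchStepT, eval_lam, Str.eval_app, Str.eval_lift, Str.eval_v0, Str.eval_v1,
    Str.eval_v2, eval_zero, eval_rc, rc_succ, eval_pair, eval_ite, eval_succ,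
    succ_app, zero_add]
  rw [eval_chi _ arith_branchFm (by exact hμ)]
  simp only [sat_branchFm]
  split_ifs <;> simp_all

theorem exists_branch_succ (hμ : IsMu μ) (n : M.C .nat) :
    ∃ b, branch μ X (n + 1) = pair (branch μ X n) b := by
  rw [branch_succ hμ]
  split_ifs
  exacts [⟨_, rfl⟩, ⟨_, rfl⟩]

/-- Pigeonhole along the branch: when only boundedly many numbers extend the current pattern by `0`,
unboundedly many extend it by `1`. -/
theorem branch_infinite (hμ : IsMu μ) (hX : IsInfPO X) (n : M.C .nat) :
    ∀ m, ∃ j, m < j ∧ Le X j j ∧ pat μ X n j = branch μ X n := by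
  induction n using ind with
  | hP =>
    -- The induction statement has the form `∀ ∃`, so it needs the arithmetical induction provided
    -- by `μ`.
    have := Dec.arith (M.nil.cons μ |>.cons X) (φ := .all .nat (.ex .nat (.and (.lt v1 v0)
      (.and (.inField v3 v0) (.eq (patT.lift ⬝ v4 ⬝ v3 ⬝ v2 ⬝ v0) (branchT.lift ⬝ v4 ⬝ v3 ⬝ v2))))))
      (m := v1) (by simp [Fm.Arith, arith_ex, arith_and, arith_lt, arith_inField]) (by exact hμ)
    simpa [pat, branch] using this
  | h0 =>
    intro m
    obtain ⟨j, hj⟩ := hX.inf m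
    exact ⟨j, hj.1, hj.2, by simp [pat, patT, branch, branchT]⟩
  | h1 n h =>
    intro m
    rw [branch_succ hμ]
    split_ifs with h'
    · exact h' m
    · push Not at h'
      obtain ⟨m', h'⟩ := h'
      -- Beyond `m'` no `j` in the field extends the pattern by `0`, so one beyond both bounds must
      -- extend it by `1`.
      obtain ⟨j, hj, hj', hjn⟩ := h (max m m')
      refine ⟨j, (le_max_left _ _).trans_lt hj, hj', ?_⟩
      have := h' j ((le_max_right _ _).trans_lt hj) hj'
      rw [pat_succ hμ, hjn] at this ⊢
      split_ifs at this ⊢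
      · exact (this rfl).elim
      · rfl

/-- Patterns are nested pairs, so injectivity of pairing passes agreement with the branch from
length `n` down to length `k + 1`, where the last entry records comparability with `k`. -/
theorem comp_iff (hμ : IsMu μ) {n k j : M.C .nat} (hj : pat μ X n j = branch μ X n)
    (hk : k < n) : Comp X k j ↔ IsComp μ X k := by
  obtain ⟨w, rfl⟩ := nat_lt_iff.1 hk
  have h : pat μ X (k + 1) j = branch μ X (k + 1) := by
    clear hk
    -- The agreement `hj` depends on `w`, so the induction predicate is an implication between
    -- equations, which is still quantifier-free.
    induction w using ind with
    | hP =>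
      have h : Rep fun w : M.C .nat => k + 1 + w := .add (.const _) .id
      exact .imp (.eq (((Rep.const _).app h).app (.const _)) ((Rep.const _).app h)) (.eq (.const _) (.const _))
    | h0 => rwa [add_zero] at hj
    | h1 w h =>
      obtain ⟨b, hb⟩ := exists_branch_succ (X := X) hμ (k + 1 + w)
      rw [← add_assoc, pat_succ hμ, hb] at hj
      exact h (pair_inj hj).1
  obtain ⟨b, hb⟩ := exists_branch_succ (X := X) hμ k
  rw [pat_succ hμ, hb] at h
  rw [IsComp, hb]
  have hb' := (pair_inj h).2
  constructor
  · intro hc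
    rw [← hb', if_pos hc]
  · intro hc
    rw [(pair_inj hc).2] at hb'
    by_contra hc'
    simp [hc'] at hb'

theorem sat_nextFm (m j : M.C .nat) :
    M.sat (M.nil.cons μ |>.cons X |>.cons m |>.cons j) nextFm ↔
      m < j ∧ Le X j j ∧ pat μ X (m + 1) j = branch μ X (m + 1) := by
  simp [nextFm, pat, branch]

/-- Infinitely many numbers follow the branch at length `m + 1`, so the function searched has a zero
and `μ` finds one. -/
theorem next_spec (hμ : IsMu μ) (hX : IsInfPO X) (m : M.C .nat) :
    m < next μ X m ∧ Le X (next μ X m) (next μ X m) ∧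
      pat μ X (m + 1) (next μ X m) = branch μ X (m + 1) := by
  have key : ∀ j, M.eval (M.nil.cons μ |>.cons X |>.cons m |>.cons j) (nextFm.chi v3) = 0 ↔
      m < j ∧ Le X j j ∧ pat μ X (m + 1) j = branch μ X (m + 1) := by
    intro j
    rw [eval_chi _ (by simp [nextFm, arith_and, arith_lt, arith_inField, Fm.Arith]) (by exact hμ),
      ← sat_nextFm]
    simp
  have := hμ (M.eval (M.nil.cons μ |>.cons X |>.cons m) (.lam (nextFm.chi v3)))
  simp only [eval_lam, key] at this
  have h := this (branch_infinite hμ hX (m + 1) m)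
  simpa only [next, nextT, eval_lam, Str.eval_app, Str.eval_v2] using h

theorem enum_zero : enum μ X 0 = next μ X 0 := by
  simp [enum, enumT, enumStepT, next]

theorem enum_succ (i : M.C .nat) : enum μ X (i + 1) = next μ X (enum μ X i) := by
  simp [enum, enumT, enumStepT, next]

theorem Rep.enum {f : M.C .nat → M.C .nat} (hf : Rep f) : Rep fun x => enum μ X (f x) :=
  (Rep.const _).app hf

theorem enum_field (hμ : IsMu μ) (hX : IsInfPO X) (i : M.C .nat) :
    Le X (enum μ X i) (enum μ X i) := by
  rcases eq_zero_or_succ i with rfl | ⟨i, rfl⟩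
  · rw [enum_zero]
    exact (next_spec hμ hX _).2.1
  · rw [enum_succ]
    exact (next_spec hμ hX _).2.1

theorem le_enum (hμ : IsMu μ) (hX : IsInfPO X) (i : M.C .nat) : i ≤ enum μ X i := by
  induction i using ind with
  | hP => exact .le .id (.enum .id)
  | h0 => exact nat_zero_le _
  | h1 i h =>
    rw [enum_succ, ← nat_lt_iff]
    exact h.trans_lt (next_spec hμ hX _).1

theorem enum_mono (hμ : IsMu μ) (hX : IsInfPO X) (i w : M.C .nat) :
    enum μ X i ≤ enum μ X (i + w) := by
  induction w using ind with
  | hP => exact .le (.const _) (.enum (.add (.const _) .id))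
  | h0 => rw [add_zero]
  | h1 w h =>
    rw [← add_assoc, enum_succ]
    exact h.trans (next_spec hμ hX _).1.le

/-- The term at `j` is chosen to follow the branch on all numbers up to the preceding term, and that
range includes the term at `i`. So its comparability with the latter is read off the branch. -/
theorem enum_comp (hμ : IsMu μ) (hX : IsInfPO X) {i j : M.C .nat} (h : i < j) :
    Comp X (enum μ X i) (enum μ X j) ↔ IsComp μ X (enum μ X i) := by
  obtain ⟨w, rfl⟩ := lt_def.1 h
  rw [← add_assoc, enum_succ]
  exact comp_iff hμ (next_spec hμ hX _).2.2 (nat_lt_succ.2 (enum_mono hμ hX i w))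

theorem sat_homFm (x : M.C .nat) : M.sat (M.nil.cons μ |>.cons X |>.cons x) homFm ↔
    (∃ i, enum μ X i = x) ∧
      ((∀ k, ∃ n, k < n ∧ (∃ i, enum μ X i = n) ∧ IsComp μ X n) ↔ IsComp μ X x) := by
  simp only [homFm, rangeFm, compFm, Str.sat_and, Str.sat_ex, Str.sat_iff, Str.sat_all, Str.sat_eq,
    sat_lt, Str.eval_app, Str.eval_lift, Str.eval_wk, Str.eval_v0, Str.eval_v1, Str.eval_v2,
    Str.eval_v3, Str.eval_v4, eval_pair, eval_succ, succ_app, eval_zero]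
  rfl

theorem arith_homFm : homFm.Arith := by
  simp [homFm, rangeFm, compFm, Fm.iff, arith_ex, arith_and, arith_lt, Fm.Arith]

open Classical in
theorem homT_app (hμ : IsMu μ) (x : M.C .nat) :
    M.app (M.app (M.app (M.eval M.nil homT) μ) X) x =
      if M.sat (M.nil.cons μ |>.cons X |>.cons x) homFm then 1 else 0 := by
  simp only [homT, eval_lam, eval_ite, eval_chi (M.nil.cons μ |>.cons X |>.cons x) arith_homFm
    (m := v2) (by exact hμ), Str.eval_app, eval_succ, succ_app, eval_zero, zero_add]
  by_cases h : M.sat (M.nil.cons μ |>.cons X |>.cons x) homFm <;> simp [h]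

theorem isSolution_homT (hμ : IsMu μ) (hX : IsInfPO X) :
    IsSolution X (M.app (M.app (M.eval M.nil homT) μ) X) := by
  have mem : ∀ x, M.app (M.app (M.app (M.eval M.nil homT) μ) X) x = 1 ↔ (∃ i, enum μ X i = x) ∧
      ((∀ k, ∃ n, k < n ∧ (∃ i, enum μ X i = n) ∧ IsComp μ X n) ↔ IsComp μ X x) := by
    intro x
    rw [homT_app hμ, ← sat_homFm]
    simp
  refine ⟨fun n => ?_, fun n hn => ?_, fun k => ?_, ?_⟩
  · rw [homT_app hμ]
    split_ifs <;> simp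
  · obtain ⟨⟨i, rfl⟩, -⟩ := (mem n).1 hn
    exact enum_field hμ hX i
  · simp only [mem]
    by_cases hB : ∀ k, ∃ n, k < n ∧ (∃ i, enum μ X i = n) ∧ IsComp μ X n
    · obtain ⟨n, hn, hn', hc⟩ := hB k
      exact ⟨n, hn, hn', iff_of_true hB hc⟩
    · obtain ⟨k', hk'⟩ := not_forall.1 hB
      -- No element beyond `k'` has comparable type, so it suffices to go beyond both `k` and `k'`;
      -- the enumeration dominates its index.
      have h := nat_lt_iff.2 (le_enum hμ hX (max k k' + 1))
      refine ⟨_, (le_max_left _ _).trans_lt h, ⟨_, rfl⟩, iff_of_false hB fun hc => hk' ?_⟩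
      exact ⟨_, (le_max_right _ _).trans_lt h, ⟨_, rfl⟩, hc⟩
  · simp only [mem]
    by_cases hB : ∀ k, ∃ n, k < n ∧ (∃ i, enum μ X i = n) ∧ IsComp μ X n
    · left
      rintro _ _ ⟨⟨i, rfl⟩, hi⟩ ⟨⟨j, rfl⟩, hj⟩
      rcases lt_trichotomy i j with h | rfl | h
      · exact (enum_comp hμ hX h).2 (hi.1 hB)
      · exact .inl (enum_field hμ hX i)
      · exact ((enum_comp hμ hX h).2 (hj.1 hB)).symm
    · right
      rintro _ _ ⟨⟨i, rfl⟩, hi⟩ ⟨⟨j, rfl⟩, hj⟩ hne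
      rw [← not_or]
      rcases lt_trichotomy i j with h | rfl | h
      · exact fun hc => hB (hi.2 ((enum_comp hμ hX h).1 hc))
      · exact (hne rfl).elim
      · exact fun hc => hB (hj.2 ((enum_comp hμ hX h).1 (Comp.symm hc)))

end Model

/-! ### Closedness of the terms for the homogeneous set -/

theorem closed_patT : patT.Closed := fun τ n => by
  have h : ((Fm.or (.le v3 v0 v2) (.le v3 v2 v0)).chi v4 :
      Tm [.nat, .nat, .nat, .one, .two] .nat).Fresh τ n :=
    fresh_chi (by simp [Fm.or, Fm.not, Fm.le, Fm.mem, Fm.Fresh, fresh_pair, Tm.Fresh]) (by simp [Tm.Fresh])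
  simp [patT, patStepT, Tm.Fresh, fresh_pair, h]

theorem closed_branchT : branchT.Closed := fun τ n => by
  have h : (branchFm.chi v3).Fresh τ n :=
    fresh_chi (by simp [branchFm, Fm.ex, Fm.and, Fm.not, Fm.lt, Fm.exx, Fm.inField, Fm.le, Fm.mem,
      Fm.Fresh, fresh_pair, fresh_add, closed_patT τ n, Tm.Fresh]) (by simp [Tm.Fresh])
  simp [branchT, branchStepT, Tm.Fresh, fresh_pair, fresh_ite, h]

theorem closed_nextT : nextT.Closed := fun τ n => by
  have h : (nextFm.chi v3).Fresh τ n :=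
    fresh_chi (by simp [nextFm, Fm.ex, Fm.and, Fm.not, Fm.lt, Fm.exx, Fm.inField, Fm.le, Fm.mem,
      Fm.Fresh, fresh_pair, fresh_add, closed_patT τ n, closed_branchT τ n, Tm.Fresh])
      (by simp [Tm.Fresh])
  simp [nextT, Tm.Fresh, h]

theorem closed_enumT : enumT.Closed := fun τ n => by
  simp [enumT, enumStepT, Tm.Fresh, closed_nextT τ n]

theorem closed_homT : homT.Closed := fun τ n => by
  have h : (homFm.chi v2).Fresh τ n :=
    fresh_chi (by simp [homFm, rangeFm, compFm, Fm.iff, Fm.ex, Fm.and, Fm.not, Fm.lt, Fm.exx,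
      Fm.Fresh, fresh_pair, fresh_add, closed_enumT τ n, closed_branchT τ n, Tm.Fresh])
      (by simp [Tm.Fresh])
  simp [homT, Tm.Fresh, fresh_ite, h]

/-! ### Both principles from `μ` -/

theorem Model.sat_UCAC_homT {M : Model} {μ : M.C .two} (h : M.sat (M.nil.cons μ) MU) :
    M.sat (M.nil.cons (M.app (M.eval M.nil homT) μ)) UCAC :=
  (sat_UCAC _).2 fun _ => isSolution_homT ((sat_MU μ).1 h)

theorem Model.sat_USCAC_of_UCAC {M : Model} {Ψ : M.C (.one ⇾ .one)}
    (h : M.sat (M.nil.cons Ψ) UCAC) : M.sat (M.nil.cons Ψ) USCAC :=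
  (sat_USCAC _).2 fun X hX _ => (sat_UCAC _).1 h X hX

theorem explicit_MU {B : Fm [Ty.one ⇾ Ty.one]}
    (hB : ∀ (M : Model) (Ψ : M.C (.one ⇾ .one)), M.sat (M.nil.cons Ψ) UCAC →
      M.sat (M.nil.cons Ψ) B) : Explicit MU B := by
  refine ⟨homT, closed_homT, provable_of_sat fun M => ?_⟩
  simp only [Str.sat_all, Str.sat_imp, Str.sat_inst, Str.eval_app, Str.eval_lift, Str.eval_v0]
  exact fun μ hμ => hB M _ (Model.sat_UCAC_homT hμ)

end RCAω

theorem mainTheorem11 :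
    (RCAω.Provable (.iff (.ex _ RCAω.UCAC) (.ex _ RCAω.MU)) ∧
      RCAω.ExplicitSearch RCAω.UCAC RCAω.MU ∧ RCAω.Explicit RCAω.MU RCAω.UCAC) ∧
    (RCAω.Provable (.iff (.ex _ RCAω.MU) (.ex _ RCAω.USCAC)) ∧
      RCAω.Explicit RCAω.MU RCAω.USCAC ∧ RCAω.ExplicitSearch RCAω.USCAC RCAω.MU) := by
  refine ⟨⟨RCAω.provable_of_sat fun M => ?_,
      RCAω.explicitSearch_MU RCAω.Model.isSolution_of_UCAC, RCAω.explicit_MU fun _ _ h => h⟩,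
    RCAω.provable_of_sat fun M => ?_, RCAω.explicit_MU fun _ _ => RCAω.Model.sat_USCAC_of_UCAC,
      RCAω.explicitSearch_MU RCAω.Model.isSolution_of_USCAC⟩
  · rw [RCAω.Str.sat_iff, RCAω.Str.sat_ex, RCAω.Str.sat_ex]
    exact ⟨fun ⟨Ψ, h⟩ => RCAω.Model.exists_mu (RCAω.Model.isSolution_of_UCAC M Ψ h),
      fun ⟨_, h⟩ => ⟨_, RCAω.Model.sat_UCAC_homT h⟩⟩
  · rw [RCAω.Str.sat_iff, RCAω.Str.sat_ex, RCAω.Str.sat_ex]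
    exact ⟨fun ⟨_, h⟩ => ⟨_, RCAω.Model.sat_USCAC_of_UCAC (RCAω.Model.sat_UCAC_homT h)⟩,
      fun ⟨Ψ, h⟩ => RCAω.Model.exists_mu (RCAω.Model.isSolution_of_USCAC M Ψ h)⟩
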